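/- **Conventions.** Let $\bar a,a$ be boson operators, i.e. elements of an associative unital algebra $A$ over $\mathbb R$ (or $\mathbb C$) with $[\bar a,a]=1$, let $h$ be a formal parameter, and put in $A[[h]]$ $$J_+=-\tfrac12a^2,\quad J_-=\tfrac12\bar a^2,\quad J_0=\tfrac12(a\bar a+\bar aa),\quad \sigma=-\ln(1-2hJ_+).$$ The adjoint action of the Jordanian quantum algebra $\mathcal U_h(sl(2))$ on $t\in A[[h]]$ is $$\mathrm{ad}J_0(t)=[J_0,t]e^{-\sigma},\qquad \mathrm{ad}J_+(t)=e^{-\sigma}[J_+e^{\sigma},t],$$ $$\mathrm{ad}J_-(t)=[J_-+hJ_0+\tfrac h2J_0^2,t]e^{-\sigma}-h[J_0,t]e^{-2\sigma}-\tfrac h2[J_0,[J_0,t]]e^{-2\sigma}.$$ The $h$-symplecton is the family $\tilde P_j^m\in A[[h]]$ ($j\in\frac12\mathbb Z_{\ge0}$, $m=-j,-j+1,\dots,j$) with $$\mathrm{ad}J_\pm(\tilde P_j^m)=\sqrt{(j\mp m)(j\pm m+1)}\,\tilde P_j^{m\pm1},\qquad \mathrm{ad}J_0(\tilde P_j^m)=2m\tilde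 P_j^m,$$ normalized by $\tilde P_j^j=\frac{1}{\sqrt{(2j)!}}\,a^{2j}e^{j\sigma}$. Let $C^{j_1,j_2,j}_{m_1,m_2,m}$ be the $sl(2)$ Clebsch–Gordan coefficients (Condon–Shortley phases), and let $(F^{-1})^{j,j'}_{n,n'\ m,m'}$ be the matrix elements $\langle jn|\otimes\langle j'n'|\,\mathcal F^{-1}\,|jm\rangle\otimes|j'm'\rangle$ of the inverse of the twist $\mathcal F=\exp(-\frac12J_0\otimes\sigma)$ on the tensor product of the irreducible representations of spins $j$ and $j'$, where $J_\pm|jm\rangle=\sqrt{(j\mp m)(j\pm m+1)}\,|j\,m\pm1\rangle$ and $J_0|jm\rangle=2m|jm\rangle$. **Theorem 1 (product law for the $h$-symplecton).** For all spins $j,j'$ and weights $m,m'$, $$\tilde P_j^m\tilde P_{j'}^{m'}=\sum_{k=|j-j'|}^{j+j'}\ \sum_{n,n'}\ \langle k|j|j'\rangle\,(F^{-1})^{j,j'}_{n,n'\ m,m'}\,C^{j',j,k}_{n',m,n'+m}\,\tilde P_k^{n'+m},$$ where $n\in\{-j,\dots,j\}$, $n'\in\{-j',\dots,j'\}$, terms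 with $|n'+m|>k$ are zero, and $$\langle k|j|j'\rangle=2^{k-j-j'}(2k+1)^{-1/2}\nabla(kjj'),\qquad \nabla(abc)=\left[\frac{(a+b+c+1)!}{(a+b-c)!\,(a-b+c)!\,(-a+b+c)!}\right]^{1/2}.$$ If the $h$-symplecton is normalized by $\tilde P_j^j=a^{2j}e^{j\sigma}$ instead, the same formula holds with $\langle k|j|j'\rangle$ replaced by $\sqrt{(2j)!\,(2j')!/(2k)!}\;\langle k|j|j'\rangle$. -/

import Mathlib

/-!
Conventions. A spin `j ∈ ½ℕ` is represented by the natural number `J = 2j`, and a weight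
`m ∈ {-j, …, j}` by the integer `M = 2m`.  The weights of spin `j` are indexed by `Fin (J + 1)`.
The deformation parameter `h` is a formal variable: the deformed objects are formal power series
in `h` with coefficients in a (noncommutative) real algebra.
-/

noncomputable section

namespace HSymplecton

/-! ### Exponential and logarithm of formal power series over a noncommutative algebra -/

section Formal

variable {R : Type*} [Ring R] [Algebra ℝ R]

/-- The deformation parameter `h`, as an element of `R⟦h⟧`. -/
def hbar : PowerSeries R := PowerSeries.X

/-- The inclusion `R → R⟦h⟧`. -/
def const (x : R) : PowerSeries R := PowerSeries.C x

/-- `exp f = ∑ fᵏ / k!`, for `f ∈ h R⟦h⟧` (only the terms `k ≤ n` contribute to the coefficient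
of `hⁿ`). -/
def fexp (f : PowerSeries R) : PowerSeries R :=
  PowerSeries.mk fun n =>
    PowerSeries.coeff n (∑ k ∈ Finset.range (n + 1), ((k.factorial : ℝ)⁻¹) • f ^ k)

/-- `-ln (1 - f) = ∑_{k ≥ 1} fᵏ / k`, for `f ∈ h R⟦h⟧`. -/
def negLogOneSub (f : PowerSeries R) : PowerSeries R :=
  PowerSeries.mk fun n =>
    PowerSeries.coeff n (∑ k ∈ Finset.Icc 1 n, ((k : ℝ)⁻¹) • f ^ k)

/-- `σ = -ln (1 - 2 h J₊)`. -/
def sigma (Jp : R) : PowerSeries R :=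
  negLogOneSub ((2 : ℝ) • (hbar * const Jp))

end Formal

/-! ### The boson realization and the adjoint action of `U_h(sl(2))` -/

section Boson

variable {A : Type*} [Ring A] [Algebra ℝ A]

/-- `J₊ = -a² / 2`. -/
def bosonJp (a : A) : A := (-(1 / 2) : ℝ) • a ^ 2

/-- `J₋ = ā² / 2`. -/
def bosonJm (abar : A) : A := ((1 / 2) : ℝ) • abar ^ 2

/-- `J₀ = (a ā + ā a) / 2`. -/
def bosonJ0 (a abar : A) : A := ((1 / 2) : ℝ) • (a * abar + abar * a)

/-- `e^{c σ}` in the boson realization. -/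
def expSigma (a : A) (c : ℝ) : PowerSeries A := fexp (c • sigma (bosonJp a))

/-- `ad J₀ (t) = [J₀, t] e^{-σ}`. -/
def adJ0 (a abar : A) (t : PowerSeries A) : PowerSeries A :=
  ⁅const (bosonJ0 a abar), t⁆ * expSigma a (-1)

/-- `ad J₊ (t) = e^{-σ} [J₊ e^{σ}, t]`. -/
def adJp (a : A) (t : PowerSeries A) : PowerSeries A :=
  expSigma a (-1) * ⁅const (bosonJp a) * expSigma a 1, t⁆

/-- `ad J₋ (t) = [J₋ + h J₀ + (h/2) J₀², t] e^{-σ} - h [J₀, t] e^{-2σ}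
- (h/2) [J₀, [J₀, t]] e^{-2σ}`. -/
def adJm (a abar : A) (t : PowerSeries A) : PowerSeries A :=
  ⁅const (bosonJm abar) + hbar * const (bosonJ0 a abar)
      + ((1 / 2) : ℝ) • (hbar * const (bosonJ0 a abar) ^ 2), t⁆ * expSigma a (-1)
    - hbar * ⁅const (bosonJ0 a abar), t⁆ * expSigma a (-2)
    - ((1 / 2) : ℝ) • (hbar * ⁅const (bosonJ0 a abar), ⁅const (bosonJ0 a abar), t⁆⁆
        * expSigma a (-2))

end Boson

/-! ### Irreducible representations of `sl(2)`, the twist, Clebsch–Gordan coefficients -/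

/-- Twice the weight of the basis vector number `s` of the spin `J/2` representation. -/
def wt (J : ℕ) (s : Fin (J + 1)) : ℤ := (J : ℤ) - 2 * (s : ℤ)

/-- `√((j - m)(j + m + 1))`, with `J = 2j`, `M = 2m`. -/
def raiseCoeff (J : ℕ) (M : ℤ) : ℝ :=
  Real.sqrt ((((J : ℝ) - M) / 2) * (((J : ℝ) + M) / 2 + 1))

/-- `√((j + m)(j - m + 1))`, with `J = 2j`, `M = 2m`. -/
def lowerCoeff (J : ℕ) (M : ℤ) : ℝ :=
  Real.sqrt ((((J : ℝ) + M) / 2) * (((J : ℝ) - M) / 2 + 1))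

/-- The family `P J M` (for spins `j = J/2` and weights `m = M/2`) of elements of `A⟦h⟧` is the
`h`-symplecton with leading constants `ν`: for each `j` it satisfies
`ad J_± (P_j^m) = √((j ∓ m)(j ± m + 1)) P_j^{m ± 1}` and `ad J₀ (P_j^m) = 2 m P_j^m`, and its
highest-weight element is `P_j^j = ν_{2j} a^{2j} e^{jσ}`.  (The values `P J M` where `M/2` is
not a weight of spin `J/2` are irrelevant.) -/
structure IsHSymplecton {A : Type*} [Ring A] [Algebra ℝ A] (a abar : A) (ν : ℕ → ℝ)
    (P : ℕ → ℤ → PowerSeries A) : Prop where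
  ad_J0 : ∀ (J : ℕ) (s : Fin (J + 1)),
    adJ0 a abar (P J (wt J s)) = ((wt J s : ℤ) : ℝ) • P J (wt J s)
  ad_Jp : ∀ (J : ℕ) (s : Fin (J + 1)),
    adJp a (P J (wt J s)) = raiseCoeff J (wt J s) • P J (wt J s + 2)
  ad_Jm : ∀ (J : ℕ) (s : Fin (J + 1)),
    adJm a abar (P J (wt J s)) = lowerCoeff J (wt J s) • P J (wt J s - 2)
  top : ∀ J : ℕ, P J J = ν J • (const (a ^ J) * expSigma a ((J : ℝ) / 2))

/-- The matrix of `J₊` in the spin `J/2` representation: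
`J₊ |j m⟩ = √((j - m)(j + m + 1)) |j m+1⟩`. -/
def repJp (J : ℕ) : Matrix (Fin (J + 1)) (Fin (J + 1)) ℝ :=
  Matrix.of fun t s => if wt J t = wt J s + 2 then raiseCoeff J (wt J s) else 0

/-- The matrix of `J₀` in the spin `J/2` representation: `J₀ |j m⟩ = 2 m |j m⟩`. -/
def repJ0 (J : ℕ) : Matrix (Fin (J + 1)) (Fin (J + 1)) ℝ :=
  Matrix.diagonal fun s => ((wt J s : ℤ) : ℝ)

/-- The algebra of operators on the tensor product of the spin `J/2` and `J'/2`
representations. -/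
abbrev TensorEnd (J J' : ℕ) : Type :=
  Matrix (Fin (J + 1) × Fin (J' + 1)) (Fin (J + 1) × Fin (J' + 1)) ℝ

/-- `J₀ ⊗ σ` on the tensor product of the spin `J/2` and `J'/2` representations. -/
def J0TensorSigma (J J' : ℕ) : PowerSeries (TensorEnd J J') :=
  PowerSeries.mk fun n =>
    Matrix.kronecker (repJ0 J) (PowerSeries.coeff n (sigma (repJp J')))

/-- The twist element `F = exp (-½ J₀ ⊗ σ)` on the tensor product of the spin `J/2` and `J'/2`
representations. -/
def twist (J J' : ℕ) : PowerSeries (TensorEnd J J') :=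
  fexp ((-(1 / 2) : ℝ) • J0TensorSigma J J')

/-- The inverse `F⁻¹` of the twist element. -/
def twistInv (J J' : ℕ) : PowerSeries (TensorEnd J J') :=
  PowerSeries.invOfUnit (twist J J') 1

theorem constantCoeff_twist (J J' : ℕ) :
    PowerSeries.constantCoeff (twist J J') = ((1 : (TensorEnd J J')ˣ) : TensorEnd J J') := by
  rw [← PowerSeries.coeff_zero_eq_constantCoeff_apply]
  simp [twist, fexp]

theorem twist_mul_twistInv (J J' : ℕ) : twist J J' * twistInv J J' = 1 :=
  PowerSeries.mul_invOfUnit _ _ (constantCoeff_twist J J')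

theorem twistInv_mul_twist (J J' : ℕ) : twistInv J J' * twist J J' = 1 :=
  PowerSeries.invOfUnit_mul _ _ (constantCoeff_twist J J')

/-- The matrix element `(F⁻¹)_{n,n';m,m'} = ⟨j n| ⊗ ⟨j' n'| F⁻¹ |j m⟩ ⊗ |j' m'⟩`, a formal power
series in `h`; `t, t', s, s'` number the weights `n, n', m, m'`. -/
def twistInvEntry (J J' : ℕ) (t : Fin (J + 1)) (t' : Fin (J' + 1))
    (s : Fin (J + 1)) (s' : Fin (J' + 1)) : PowerSeries ℝ :=
  PowerSeries.mk fun n => (PowerSeries.coeff n (twistInv J J')) (t, t') (s, s')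

/-- `1 / x!`, understood as `0` for negative `x`. -/
def invFact (x : ℤ) : ℝ := if x < 0 then 0 else ((x.toNat.factorial : ℝ))⁻¹

/-- `x!` for a nonnegative integer `x`. -/
def fact (x : ℤ) : ℝ := (x.toNat.factorial : ℝ)

/-- The `sl(2)` Clebsch–Gordan coefficient `C^{j₁, j₂, j}_{m₁, m₂, m}` (Condon–Shortley phases),
by Racah's formula, for spins `j₁, j₂, j` with `j` in the Clebsch–Gordan series of `j₁, j₂` and
weights `m₁, m₂` of the first two spins.  The arguments are the doubled spins and weights. -/
def clebschGordan (J₁ : ℕ) (M₁ : ℤ) (J₂ : ℕ) (M₂ : ℤ) (J : ℕ) (M : ℤ) : ℝ :=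
  if M = M₁ + M₂ ∧ |M| ≤ (J : ℤ) then
    Real.sqrt (((J : ℝ) + 1) * fact (((J₁ : ℤ) + J₂ - J) / 2) * fact (((J₁ : ℤ) - J₂ + J) / 2)
        * fact ((-(J₁ : ℤ) + J₂ + J) / 2) / fact (((J₁ : ℤ) + J₂ + J) / 2 + 1))
      * Real.sqrt (fact ((J₁ + M₁) / 2) * fact ((J₁ - M₁) / 2)
        * fact ((J₂ + M₂) / 2) * fact ((J₂ - M₂) / 2)
        * fact ((J + M) / 2) * fact ((J - M) / 2))
      * ∑ k ∈ Finset.range ((J₁ + J₂ - J) / 2 + 1),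
          (-1 : ℝ) ^ k * invFact k * invFact (((J₁ : ℤ) + J₂ - J) / 2 - k)
            * invFact ((J₁ - M₁) / 2 - k) * invFact ((J₂ + M₂) / 2 - k)
            * invFact (((J : ℤ) - J₂ + M₁) / 2 + k) * invFact (((J : ℤ) - J₁ - M₂) / 2 + k)
  else 0

/-- The triangle function
`∇(abc) = [(a+b+c+1)! / ((a+b-c)! (a-b+c)! (-a+b+c)!)]^{1/2}`; the arguments are the doubled
spins, which satisfy the triangle conditions. -/
def nabla (a b c : ℕ) : ℝ :=
  Real.sqrt (fact (((a : ℤ) + b + c) / 2 + 1)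
    / (fact (((a : ℤ) + b - c) / 2) * fact (((a : ℤ) - b + c) / 2)
        * fact ((-(a : ℤ) + b + c) / 2)))

/-- `⟨k|j|j'⟩ = 2^{k-j-j'} (2k+1)^{-1/2} ∇(k j j')`. -/
def triangleFactor (K J J' : ℕ) : ℝ :=
  (2 : ℝ) ^ (((K : ℤ) - J - J') / 2) * (Real.sqrt ((K : ℝ) + 1))⁻¹ * nabla K J J'

/-- The doubled spins `2k`, for `k = |j - j'|, |j - j'| + 1, …, j + j'`. -/
def couplings (J J' : ℕ) : Finset ℕ :=
  (Finset.range (J + J' + 1)).filter fun K =>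
    |(J : ℤ) - J'| ≤ (K : ℤ) ∧ Even (K + J + J')

end HSymplecton

end

/-!
The proof reduces the deformed product law to the undeformed one, and the undeformed one to the
Moyal product of polynomials in the two boson symbols.

*The `h`-symplecton is the symplecton times `e^{mσ}`.* Let `p_j^m` be the value of `P_j^m` at
`h = 0`. If `x` does not involve `h` and has weight `m`, then
`ad J₋ (x e^{mσ}) = [J₋, x] e^{(m-1)σ}` (`adJm_const_mul_expSigma`); lowering from the highest
weight therefore gives `P_j^m = p_j^m e^{mσ}` (`IsHSymplecton.eq_const_mul_expSigma`).

*The twist.* On a weight vector of the first factor `J₀` is a number, so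
`F⁻¹ |j m⟩ ⊗ v = |j m⟩ ⊗ e^{mσ} v` (`twistInvEntry_eq`). In the algebra, moving `e^{mσ}` from the
left of `p_{j'}^{m'}` to its right turns this vector into
`∑ ⟨n'| e^{mσ} |m'⟩ p_{j'}^{n'} e^{(m + n' - m')σ}` (`expSigma_mul_const`), because left
multiplication by `J₊` is the sum of the commuting operators `ad J₊` and right multiplication.
Hence `P_j^m P_{j'}^{m'} = ∑ ⟨n'| e^{mσ} |m'⟩ p_j^m p_{j'}^{n'} e^{(m + n')σ}`, and only the
undeformed product `p_j^m p_{j'}^{n'}` remains to be expanded.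

*The undeformed product.* Lowering `a^{2j}` gives the Weyl-ordered monomials: `p_j^m` is a multiple
of the one of degree `j + m` in `a` and `j - m` in `ā` (`IsHSymplecton.constantCoeff_eq`). Their
products are given by the Moyal product (`weyl_mul_weyl`), which is proved by induction on the
degrees of the first factor. Sorted by the total number `n = j + j' - k` of contractions, its
coefficients are `2⁻ⁿ` times the sums in Racah's formula for the Clebsch–Gordan coefficients
(`moyalSum_eq_sum_racahSum`), and `⟨k|j|j'⟩` accounts for the remaining factors
(`triangleFactor_mul_clebschGordan`).
-/

namespace HSymplecton

noncomputable section

/-! ### Formal powers `(1 - X)^{-c}` -/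

section Scalar

/-- The coefficient `c (c + 1) ⋯ (c + n - 1) / n!` of `Xⁿ` in `(1 - X)^{-c}`. -/
def negBinom (c : ℝ) (n : ℕ) : ℝ :=
  (∏ i ∈ Finset.range n, (c + i)) / n.factorial

@[simp] theorem negBinom_zero (c : ℝ) : negBinom c 0 = 1 := by simp [negBinom]

theorem negBinom_succ (c : ℝ) (n : ℕ) :
    ((n : ℝ) + 1) * negBinom c (n + 1) = (c + n) * negBinom c n := by
  have h : (n.factorial : ℝ) ≠ 0 := by positivity
  have h' : (n : ℝ) + 1 ≠ 0 := by positivity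
  rw [negBinom, negBinom, Finset.prod_range_succ, Nat.factorial_succ]
  push_cast
  field_simp

theorem negBinom_succ' (c : ℝ) (n : ℕ) :
    ((n : ℝ) + 1) * negBinom c (n + 1) = c * negBinom (c + 1) n := by
  have h : (n.factorial : ℝ) ≠ 0 := by positivity
  have h' : (n : ℝ) + 1 ≠ 0 := by positivity
  rw [negBinom, negBinom, Finset.prod_range_succ', Nat.factorial_succ]
  push_cast
  field_simp
  simp only [add_zero, add_right_comm, add_assoc, mul_comm]

/-- Trinomial revision for the coefficients `b_n(c)` of `(1 - X)^{-c}`: `b_{k+n}(c) C(k+n, k) = b_k(c) b_n(c+k)`. -/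
theorem negBinom_mul_negBinom (c : ℝ) (k n : ℕ) :
    negBinom c k * negBinom (c + k) n = negBinom c (k + n) * ((k + n).choose k : ℝ) := by
  have h := Nat.add_choose_mul_factorial_mul_factorial n k
  rw [add_comm n k, mul_right_comm] at h
  have h' : (((k + n).choose k : ℕ) : ℝ) * k.factorial * n.factorial = (k + n).factorial := by
    exact_mod_cast h
  have h1 : (k.factorial : ℝ) ≠ 0 := by positivity
  have h2 : (n.factorial : ℝ) ≠ 0 := by positivity
  have h3 : ((k + n).factorial : ℝ) ≠ 0 := by positivity
  rw [negBinom, negBinom, negBinom, Finset.prod_range_add, ← h']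
  have h4 : (((k + n).choose k : ℕ) : ℝ) ≠ 0 := by
    rw [← h'] at h3
    exact fun h0 => h3 (by rw [h0]; simp)
  field_simp
  congr 1
  exact Finset.prod_congr rfl fun i _ => by push_cast; ring

/-- `(1 - X)^{-c}` as a real power series. -/
def negPow (c : ℝ) : PowerSeries ℝ := PowerSeries.mk (negBinom c)

open PowerSeries in
/-- `(1 - X)^{-c}` is the only solution of `(1 - X) G' = c G` with constant term `1`. -/
theorem eq_negPow_of_deriv {c : ℝ} {G : PowerSeries ℝ} (h0 : coeff 0 G = 1)
    (h : derivative ℝ G = X * derivative ℝ G + c • G) : G = negPow c := by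
  ext n
  rw [negPow, coeff_mk]
  induction n with
  | zero => simpa using h0
  | succ n ih =>
    have hn : (n : ℝ) + 1 ≠ 0 := by positivity
    have e := congrArg (coeff n) h
    have e1 : coeff n (X * derivative ℝ G) = n * coeff n G := by
      cases n with
      | zero => simp
      | succ n => rw [coeff_succ_X_mul, coeff_derivative]; push_cast; ring
    rw [map_add, e1, coeff_derivative, coeff_smul, ih, smul_eq_mul] at e
    have e2 := negBinom_succ c n
    apply mul_left_cancel₀ hn
    linarith

open PowerSeries in
theorem derivative_negPow (c : ℝ) :
    derivative ℝ (negPow c) = X * derivative ℝ (negPow c) + c • negPow c := by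
  ext n
  have e1 : coeff n (X * derivative ℝ (negPow c)) = n * negBinom c n := by
    cases n with
    | zero => simp
    | succ n => rw [coeff_succ_X_mul, coeff_derivative, negPow, coeff_mk]; push_cast; ring
  rw [map_add, e1, coeff_derivative, coeff_smul, negPow, coeff_mk, coeff_mk, smul_eq_mul,
    mul_comm, negBinom_succ]
  ring

open PowerSeries in
theorem negPow_mul_negPow (c d : ℝ) : negPow c * negPow d = negPow (c + d) := by
  apply eq_negPow_of_deriv
  · simp [negPow, coeff_mul]
  · have hc := derivative_negPow c
    have hd := derivative_negPow d
    rw [Derivation.leibniz, smul_eq_mul, smul_eq_mul]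
    simp only [smul_eq_C_mul, map_add] at hc hd ⊢
    linear_combination negPow c * hd + negPow d * hc

theorem negPow_zero : negPow 0 = 1 := by
  refine (eq_negPow_of_deriv (by simp) ?_).symm
  rw [zero_smul, ← map_one (PowerSeries.C (R := ℝ)), PowerSeries.derivative_C]
  simp

end Scalar

section Fexp

variable {R : Type*} [Ring R] [Algebra ℝ R]

open PowerSeries in
/-- In the coefficient of `hⁿ` in `exp f`, the sum may be extended to any `N > n`. -/
theorem coeff_fexp_of_lt {f : PowerSeries R} (hf : constantCoeff f = 0) {n N : ℕ} (h : n < N) :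
    coeff n (fexp f) = coeff n (∑ k ∈ Finset.range N, ((k.factorial : ℝ)⁻¹) • f ^ k) := by
  rw [fexp, coeff_mk, map_sum, map_sum]
  refine Finset.sum_subset (by simpa using h) fun k _ hk => ?_
  have hk' : n < k := by rw [Finset.mem_range] at hk; omega
  have h1 : (n : ℕ∞) < k := by exact_mod_cast hk'
  rw [coeff_smul, coeff_of_lt_order n (h1.trans_le (le_order_pow_of_constantCoeff_eq_zero k hf)),
    smul_zero]

open PowerSeries in
theorem derivative_fexp {f : PowerSeries ℝ} (hf : constantCoeff f = 0) :
    derivative ℝ (fexp f) = derivative ℝ f * fexp f := by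
  ext n
  -- differentiating the partial sum loses one term, so it is needed one order higher
  have key : ∀ N : ℕ, derivative ℝ (∑ k ∈ Finset.range (N + 1), ((k.factorial : ℝ)⁻¹) • f ^ k) =
      derivative ℝ f * ∑ k ∈ Finset.range N, ((k.factorial : ℝ)⁻¹) • f ^ k := by
    intro N
    rw [Finset.sum_range_succ', map_add, map_sum, Finset.mul_sum]
    simp only [pow_zero, Derivation.map_smul, Derivation.map_one_eq_zero, smul_zero, add_zero]
    refine Finset.sum_congr rfl fun k _ => ?_
    rw [Derivation.leibniz_pow, Nat.factorial_succ, Nat.add_sub_cancel, smul_eq_mul,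
      mul_smul_comm, mul_comm (f ^ k), ← Nat.cast_smul_eq_nsmul ℝ, smul_smul]
    congr 1
    push_cast
    field_simp
  rw [coeff_derivative, coeff_fexp_of_lt hf (Nat.lt_succ_self (n + 1)), ← coeff_derivative, key,
    coeff_mul, coeff_mul]
  refine Finset.sum_congr rfl fun p hp => ?_
  have hp' := Finset.HasAntidiagonal.mem_antidiagonal.mp hp
  rw [coeff_fexp_of_lt hf (show p.2 < n + 1 by omega)]

/-- Algebra homomorphisms commute with `exp`. -/
theorem map_fexp {S : Type*} [Ring S] [Algebra ℝ S] (φ : R →ₐ[ℝ] S) (f : PowerSeries R) :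
    PowerSeries.map (φ : R →+* S) (fexp f) = fexp (PowerSeries.map (φ : R →+* S) f) := by
  ext n
  simp only [fexp, PowerSeries.coeff_map, PowerSeries.coeff_mk, map_sum, PowerSeries.coeff_smul,
    ← map_pow]
  refine Finset.sum_congr rfl fun k _ => ?_
  simp [Algebra.smul_def]

/-- The substitution `X ↦ h y`, for `y` in a noncommutative algebra. -/
def substHbarMul (y : R) : PowerSeries ℝ →ₐ[ℝ] PowerSeries R :=
  AlgHom.ofLinearMap
    { toFun := fun f => PowerSeries.mk fun n => PowerSeries.coeff n f • y ^ n
      map_add' := fun f g => by ext n; simp [add_smul]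
      map_smul' := fun c f => by ext n; simp [mul_smul] }
    (by ext n; simp [PowerSeries.coeff_one]; split_ifs with h <;> simp [h])
    (fun f g => by
      ext n
      simp only [LinearMap.coe_mk, AddHom.coe_mk, PowerSeries.coeff_mk, PowerSeries.coeff_mul,
        Finset.sum_smul]
      refine Finset.sum_congr rfl fun p hp => ?_
      rw [smul_mul_smul_comm, ← pow_add, Finset.HasAntidiagonal.mem_antidiagonal.mp hp])

@[simp] theorem coeff_substHbarMul (y : R) (f : PowerSeries ℝ) (n : ℕ) :
    PowerSeries.coeff n (substHbarMul y f) = PowerSeries.coeff n f • y ^ n := by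
  simp [substHbarMul]

theorem substHbarMul_fexp (y : R) (f : PowerSeries ℝ) :
    substHbarMul y (fexp f) = fexp (substHbarMul y f) := by
  ext n
  simp only [fexp, coeff_substHbarMul, PowerSeries.coeff_mk, ← map_pow, ← map_smul, ← map_sum]

theorem substHbarMul_negLogOneSub (y : R) (f : PowerSeries ℝ) :
    substHbarMul y (negLogOneSub f) = negLogOneSub (substHbarMul y f) := by
  ext n
  simp only [negLogOneSub, coeff_substHbarMul, PowerSeries.coeff_mk, ← map_pow, ← map_smul,
    ← map_sum]

theorem coeff_negLogOneSub_X (n : ℕ) :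
    PowerSeries.coeff n (negLogOneSub (PowerSeries.X : PowerSeries ℝ)) = (n : ℝ)⁻¹ := by
  rw [negLogOneSub, PowerSeries.coeff_mk, map_sum]
  simp only [PowerSeries.coeff_smul, PowerSeries.coeff_X_pow, smul_eq_mul, mul_ite, mul_one,
    mul_zero]
  rw [Finset.sum_ite_eq]
  rcases n with _ | n <;> simp

open PowerSeries in
theorem fexp_smul_negLogOneSub_X (c : ℝ) :
    fexp (c • negLogOneSub (X : PowerSeries ℝ)) = negPow c := by
  have h0 : constantCoeff (c • negLogOneSub (X : PowerSeries ℝ)) = 0 := by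
    rw [← coeff_zero_eq_constantCoeff_apply, coeff_smul, coeff_negLogOneSub_X]; simp
  have hL : derivative ℝ (negLogOneSub (X : PowerSeries ℝ)) =
      X * derivative ℝ (negLogOneSub (X : PowerSeries ℝ)) + 1 := by
    ext n
    have hn : (n : ℝ) + 1 ≠ 0 := by positivity
    rcases n with _ | n
    · simp [coeff_derivative, coeff_negLogOneSub_X]
    · have hn' : (n : ℝ) + 1 ≠ 0 := by positivity
      rw [map_add, coeff_succ_X_mul, coeff_derivative, coeff_derivative, coeff_negLogOneSub_X,
        coeff_negLogOneSub_X, coeff_one]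
      push_cast at hn ⊢
      simp [hn, hn']
  apply eq_negPow_of_deriv
  · simp [fexp]
  · rw [derivative_fexp h0, Derivation.map_smul]
    simp only [smul_eq_C_mul] at hL ⊢
    linear_combination C c * fexp (C c * negLogOneSub X) * hL

/-- `σ` is the series `-ln (1 - X)` at `X = 2 h J₊`. -/
theorem sigma_eq_substHbarMul (Jp : R) :
    sigma Jp = substHbarMul ((2 : ℝ) • Jp) (negLogOneSub PowerSeries.X) := by
  rw [substHbarMul_negLogOneSub, sigma]
  congr 1
  ext n
  rw [coeff_substHbarMul, PowerSeries.coeff_smul, hbar, const, PowerSeries.coeff_X]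
  rcases n with _ | _ | n <;>
    simp [PowerSeries.coeff_X]

theorem fexp_smul_sigma (c : ℝ) (Jp : R) :
    fexp (c • sigma Jp) = substHbarMul ((2 : ℝ) • Jp) (negPow c) := by
  rw [sigma_eq_substHbarMul, ← map_smul, ← substHbarMul_fexp, fexp_smul_negLogOneSub_X]

theorem fexp_smul_sigma_mul (c d : ℝ) (Jp : R) :
    fexp (c • sigma Jp) * fexp (d • sigma Jp) = fexp ((c + d) • sigma Jp) := by
  rw [fexp_smul_sigma, fexp_smul_sigma, fexp_smul_sigma, ← map_mul, negPow_mul_negPow]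

theorem fexp_zero_smul_sigma (Jp : R) : fexp ((0 : ℝ) • sigma Jp) = 1 := by
  rw [fexp_smul_sigma, negPow_zero, map_one]

theorem coeff_fexp_smul_sigma (c : ℝ) (Jp : R) (n : ℕ) :
    PowerSeries.coeff n (fexp (c • sigma Jp)) = negBinom c n • ((2 : ℝ) • Jp) ^ n := by
  rw [fexp_smul_sigma, coeff_substHbarMul, negPow, PowerSeries.coeff_mk]

end Fexp

/-! ### The boson operators and `e^{cσ}` -/

section Const

variable {R : Type*} [Ring R]

theorem const_smul [Algebra ℝ R] (r : ℝ) (x : R) : const (r • x) = r • const x := by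
  ext n; rcases n with _ | n <;> simp [const, PowerSeries.coeff_C]

theorem const_add (x y : R) : const (x + y) = const x + const y := map_add _ x y

theorem const_mul (x y : R) : const (x * y) = const x * const y := map_mul _ x y

theorem const_lie (x y : R) : const ⁅x, y⁆ = ⁅const x, const y⁆ := by
  simp only [Ring.lie_def, const, map_sub, map_mul]

theorem hbar_mul_comm (f : PowerSeries R) : hbar * f = f * hbar :=
  (PowerSeries.commute_X f).symm.eq

end Const

section Boson

variable {A : Type*} [Ring A] [Algebra ℝ A] {a abar : A}

theorem coeff_expSigma (a : A) (c : ℝ) (n : ℕ) :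
    PowerSeries.coeff n (expSigma a c) = negBinom c n • (-a ^ 2) ^ n := by
  rw [expSigma, coeff_fexp_smul_sigma, bosonJp, smul_smul]
  norm_num

theorem expSigma_mul (a : A) {c d e : ℝ} (h : c + d = e) :
    expSigma a c * expSigma a d = expSigma a e := by
  rw [expSigma, expSigma, fexp_smul_sigma_mul, h, expSigma]

theorem const_mul_expSigma (a : A) (c : ℝ) :
    const a * expSigma a c = expSigma a c * const a := by
  ext n
  rw [const, PowerSeries.coeff_C_mul, PowerSeries.coeff_mul_C, coeff_expSigma, mul_smul_comm,
    smul_mul_assoc]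
  congr 1
  exact (((Commute.refl a).pow_right 2).neg_right.pow_right n).eq

/-- `e^{-σ} = 1 - 2 h J₊ = 1 + h a²`. -/
theorem expSigma_neg_one (a : A) : expSigma a (-1) = 1 + hbar * const a ^ 2 := by
  ext n
  rw [coeff_expSigma, map_add, PowerSeries.coeff_one, hbar, const, ← map_pow]
  rcases n with _ | _ | n
  · simp
  · rw [PowerSeries.coeff_succ_X_mul]
    simp [negBinom]
  · rw [PowerSeries.coeff_succ_X_mul, PowerSeries.coeff_C]
    have : negBinom (-1) (n + 1 + 1) = 0 := by
      rw [negBinom, div_eq_zero_iff]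
      exact Or.inl (Finset.prod_eq_zero (i := 1) (by simp) (by norm_num))
    simp [this]

theorem hbar_mul_sq_mul_expSigma (a : A) (c : ℝ) :
    hbar * const a ^ 2 * expSigma a (c + 1) = expSigma a c - expSigma a (c + 1) := by
  have h := expSigma_mul a (c := -1) (d := c + 1) (e := c) (by ring)
  rw [expSigma_neg_one, add_mul, one_mul] at h
  rw [← h]; abel

theorem abar_mul_pow (hcomm : abar * a - a * abar = 1) (n : ℕ) :
    abar * a ^ n = a ^ n * abar + (n : ℝ) • a ^ (n - 1) := by
  have h : abar * a = a * abar + 1 := by rw [← hcomm]; abel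
  induction n with
  | zero => simp
  | succ n ih =>
    rw [pow_succ', ← mul_assoc, h, add_mul, mul_assoc, ih, one_mul, mul_add, mul_smul_comm,
      Nat.add_sub_cancel]
    rcases n with _ | n
    · simp
    · rw [Nat.add_sub_cancel, ← pow_succ']
      push_cast
      simp only [mul_assoc]
      module

/-- `[ā, ·] = d/da` on functions of `a`, and `d/da (1 + h a²)^{-c} = -2 c h a (1 + h a²)^{-c-1}`. -/
theorem abar_mul_expSigma (hcomm : abar * a - a * abar = 1) (c : ℝ) :
    const abar * expSigma a c =
      expSigma a c * const abar - (2 * c) • (hbar * (const a * expSigma a (c + 1))) := by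
  ext n
  rw [map_sub, PowerSeries.coeff_smul, hbar, const, const, PowerSeries.coeff_C_mul,
    PowerSeries.coeff_mul_C, coeff_expSigma]
  rcases n with _ | n
  · simp
  · rw [PowerSeries.coeff_succ_X_mul, PowerSeries.coeff_C_mul, coeff_expSigma]
    have h1 : (-a ^ 2) ^ (n + 1) = ((-1 : ℝ) ^ (n + 1)) • a ^ (2 * n + 1 + 1) := by
      rw [neg_pow, ← pow_mul, mul_add, mul_one, Algebra.smul_def]
      simp
    have h2 : a * (-a ^ 2) ^ n = ((-1 : ℝ) ^ n) • a ^ (2 * n + 1) := by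
      rw [neg_pow, ← pow_mul, pow_succ', Algebra.smul_def]
      rcases Nat.even_or_odd n with h | h <;> simp [h.neg_one_pow]
    rw [mul_smul_comm, mul_smul_comm, h2, h1, mul_smul_comm, abar_mul_pow hcomm,
      Nat.add_sub_cancel, smul_mul_assoc, smul_mul_assoc, smul_add, smul_add, sub_eq_add_neg]
    have h3 := negBinom_succ' c n
    congr 1
    simp only [smul_smul, ← neg_smul]
    congr 1
    push_cast
    rw [pow_succ]
    linear_combination (-2) * (-1) ^ n * h3

theorem const_bosonJ0 (hcomm : abar * a - a * abar = 1) :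
    const (bosonJ0 a abar) = const a * const abar + (1 / 2 : ℝ) • 1 := by
  have h : abar * a = a * abar + 1 := by rw [← hcomm]; abel
  have h1 : const (1 : A) = 1 := map_one _
  rw [bosonJ0, h, const_smul, const_add, const_add, const_mul, h1]
  module

/-- `[J₀, e^{cσ}] = 2 c (e^σ - 1) e^{cσ}`. -/
theorem bosonJ0_mul_expSigma (hcomm : abar * a - a * abar = 1) (c : ℝ) :
    const (bosonJ0 a abar) * expSigma a c = expSigma a c * const (bosonJ0 a abar)
      + (2 * c) • (expSigma a (c + 1) - expSigma a c) := by
  have h := hbar_mul_sq_mul_expSigma a c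
  rw [const_bosonJ0 hcomm, add_mul, mul_assoc, abar_mul_expSigma hcomm, mul_sub, ← mul_assoc,
    const_mul_expSigma, mul_smul_comm, ← mul_assoc, ← hbar_mul_comm, mul_assoc hbar, ← mul_assoc
    (const a) (const a), ← sq, ← mul_assoc hbar, h, mul_add, mul_assoc]
  simp only [smul_mul_assoc, mul_smul_comm, one_mul, mul_one]
  module

/-- `[J₋, e^{cσ}] = -2 c h (J₀ e^{(c+1)σ} + (c + 1) (e^{(c+1)σ} - e^{(c+2)σ}))`. -/
theorem bosonJm_mul_expSigma (hcomm : abar * a - a * abar = 1) (c : ℝ) :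
    const (bosonJm abar) * expSigma a c = expSigma a c * const (bosonJm abar)
      - (2 * c) • (hbar * (const (bosonJ0 a abar) * expSigma a (c + 1)
        + (c + 1) • (expSigma a (c + 1) - expSigma a (c + 2)))) := by
  have h1 := abar_mul_expSigma hcomm c
  have h2 := abar_mul_expSigma hcomm (c + 1)
  have h3 := hbar_mul_sq_mul_expSigma a (c + 1)
  have hab : const abar * const a = const a * const abar + 1 := by
    have h : abar * a = a * abar + 1 := by rw [← hcomm]; abel
    have h1 : const (1 : A) = 1 := map_one _
    rw [← const_mul, h, const_add, const_mul, h1]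
  rw [show c + 1 + 1 = c + 2 by ring] at h2 h3
  -- move `E ā` to `ā E` in the second half of the symmetric product `ā E ā`
  have h4 : const a * expSigma a (c + 1) * const abar = const a * const abar * expSigma a (c + 1)
      + (2 * (c + 1)) • (expSigma a (c + 1) - expSigma a (c + 2)) := by
    rw [mul_assoc, eq_add_of_sub_eq h2.symm, mul_add, mul_assoc, mul_smul_comm, ← mul_assoc _ hbar,
      ← hbar_mul_comm, mul_assoc hbar, ← mul_assoc (const a) (const a), ← sq, ← mul_assoc hbar,
      h3]
  have h5 : const abar * (const abar * expSigma a c) = expSigma a c * const abar * const abar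
      - (2 * c) • (hbar * (const a * expSigma a (c + 1) * const abar))
      - (2 * c) • (hbar * (const abar * const a * expSigma a (c + 1))) := by
    rw [h1, mul_sub, ← mul_assoc, h1, sub_mul, mul_smul_comm, smul_mul_assoc,
      ← mul_assoc _ hbar, ← hbar_mul_comm]
    simp only [mul_assoc]
  rw [bosonJm, const_smul, smul_mul_assoc, sq, const_mul, mul_assoc, h5, h4, hab,
    const_bosonJ0 hcomm]
  simp only [smul_mul_assoc, mul_smul_comm, mul_add, add_mul, mul_sub, one_mul, mul_assoc,
    smul_add, smul_sub]
  module

/-- The key computation: on `x e^{mσ}`, where `x` does not involve `h` and has weight `m`, the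
operator `ad J₋` acts as the undeformed `[J₋, ·]` on `x`, and lowers the exponent by one. -/
theorem adJm_const_mul_expSigma (hcomm : abar * a - a * abar = 1) {x : A} {m : ℝ}
    (hx : ⁅bosonJ0 a abar, x⁆ = (2 * m) • x) :
    adJm a abar (const x * expSigma a m) =
      const ⁅bosonJm abar, x⁆ * expSigma a (m - 1) := by
  have hjx : const (bosonJ0 a abar) * const x
      = const x * const (bosonJ0 a abar) + (2 * m) • const x := by
    rw [← const_smul, ← hx, const_lie, Ring.lie_def]; abel
  have hj : ∀ c : ℝ, ⁅const (bosonJ0 a abar), const x * expSigma a c⁆ = (2 * m) •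
      (const x * expSigma a c) + (2 * c) • (const x * (expSigma a (c + 1) - expSigma a c)) := by
    intro c
    rw [Ring.lie_def, ← mul_assoc, hjx, add_mul, mul_assoc, bosonJ0_mul_expSigma hcomm, mul_add,
      mul_smul_comm, smul_mul_assoc, mul_assoc]
    abel
  have hj0 : ⁅const (bosonJ0 a abar), const x * expSigma a m⁆
      = (2 * m) • (const x * expSigma a (m + 1)) := by
    rw [hj, mul_sub]; module
  have hjj : ⁅const (bosonJ0 a abar), ⁅const (bosonJ0 a abar), const x * expSigma a m⁆⁆
      = (4 * m) • (const x * ((m + 1) • expSigma a (m + 2) - expSigma a (m + 1))) := by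
    rw [hj0, Ring.lie_def, mul_smul_comm, smul_mul_assoc, ← smul_sub, ← Ring.lie_def, hj,
      show m + 1 + 1 = m + 2 by ring, mul_sub, mul_sub, mul_smul_comm]
    module
  have hj2 : ⁅const (bosonJ0 a abar) ^ 2, const x * expSigma a m⁆
      = (4 * m) • (const x * (const (bosonJ0 a abar) * expSigma a (m + 1)))
        + (8 * m ^ 2) • (const x * expSigma a (m + 1))
        - (4 * m) • (const x * ((m + 1) • expSigma a (m + 2) - expSigma a (m + 1))) := by
    have e : ∀ j t : PowerSeries A, ⁅j ^ 2, t⁆ = (2 : ℝ) • (j * ⁅j, t⁆) - ⁅j, ⁅j, t⁆⁆ := by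
      intro j t
      rw [two_smul]
      simp only [Ring.lie_def]
      noncomm_ring
    rw [e, hjj, hj0, mul_smul_comm, ← mul_assoc, hjx, add_mul, mul_assoc, smul_mul_assoc]
    module
  have hm : ⁅const (bosonJm abar), const x * expSigma a m⁆
      = const ⁅bosonJm abar, x⁆ * expSigma a m
        - (2 * m) • (hbar * (const x * (const (bosonJ0 a abar) * expSigma a (m + 1)
          + (m + 1) • (expSigma a (m + 1) - expSigma a (m + 2))))) := by
    rw [Ring.lie_def, const_lie, Ring.lie_def, mul_assoc (const x) (expSigma a m),
      eq_add_of_sub_eq (bosonJm_mul_expSigma hcomm m).symm, mul_add, mul_smul_comm,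
      ← mul_assoc _ hbar, ← hbar_mul_comm]
    simp only [mul_assoc, sub_mul]
    abel
  have hH : ∀ f t : PowerSeries A, ⁅hbar * f, t⁆ = hbar * ⁅f, t⁆ := by
    intro f t
    rw [Ring.lie_def, Ring.lie_def, mul_sub, ← mul_assoc t, ← hbar_mul_comm, mul_assoc, mul_assoc]
  have hS : ∀ f t : PowerSeries A, ⁅(1 / 2 : ℝ) • f, t⁆ = (1 / 2 : ℝ) • ⁅f, t⁆ := by
    intro f t
    rw [Ring.lie_def, Ring.lie_def, smul_sub, mul_smul_comm, smul_mul_assoc]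
  have hA : ∀ f g t : PowerSeries A, ⁅f + g, t⁆ = ⁅f, t⁆ + ⁅g, t⁆ := by
    intro f g t
    simp only [Ring.lie_def, add_mul, mul_add]
    abel
  rw [adJm, hjj, hA, hA, hS, hH, hH, hm, hj2, hj0]
  simp only [smul_mul_assoc, mul_smul_comm, mul_add, add_mul, mul_sub, sub_mul, mul_assoc,
    smul_add, smul_sub, smul_smul, expSigma_mul a (show m + -1 = m - 1 by ring),
    expSigma_mul a (show m + 1 + -1 = m by ring), expSigma_mul a (show m + 2 + -1 = m + 1 by ring),
    expSigma_mul a (show m + 1 + -2 = m - 1 by ring), expSigma_mul a (show m + 2 + -2 = m by ring)]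
  module

end Boson

/-! ### The matrix elements of the inverse twist -/

section Twist

/-- Block diagonal operators on the tensor product: a family of operators on the second factor,
indexed by the weight vectors of the first factor. -/
def blockDiag (J J' : ℕ) :
    (Fin (J + 1) → Matrix (Fin (J' + 1)) (Fin (J' + 1)) ℝ) →ₐ[ℝ] TensorEnd J J' :=
  AlgHom.ofLinearMap
    { toFun := fun Y => Matrix.of fun p q => if p.1 = q.1 then Y p.1 p.2 q.2 else 0
      map_add' := fun Y Z => by ext p q; by_cases h : p.1 = q.1 <;> simp [h]
      map_smul' := fun c Y => by ext p q; by_cases h : p.1 = q.1 <;> simp [h] }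
    (by
      ext ⟨p, p'⟩ ⟨q, q'⟩
      by_cases h : p = q <;> simp [h, Matrix.one_apply])
    (fun Y Z => by
      ext ⟨p, p'⟩ ⟨q, q'⟩
      by_cases h : p = q
      · subst h
        simp [Matrix.mul_apply, Fintype.sum_prod_type_right]
      · simp [Matrix.mul_apply, Fintype.sum_prod_type_right, h])

theorem blockDiag_apply (J J' : ℕ) (Y : Fin (J + 1) → Matrix (Fin (J' + 1)) (Fin (J' + 1)) ℝ)
    (t : Fin (J + 1)) (t' : Fin (J' + 1)) (s : Fin (J + 1)) (s' : Fin (J' + 1)) :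
    blockDiag J J' Y (t, t') (s, s') = if t = s then Y t t' s' else 0 := by
  simp [blockDiag]

/-- The family of the operators `c m σ` on the spin `J'/2` representation, where `m` runs over the
weights of spin `J/2`, as a single power series over a product algebra. -/
def sigmaFamily (J J' : ℕ) (c : ℝ) :
    PowerSeries (Fin (J + 1) → Matrix (Fin (J' + 1)) (Fin (J' + 1)) ℝ) :=
  PowerSeries.mk fun n s => (c * (wt J s : ℤ)) • PowerSeries.coeff n (sigma (repJp J'))

/-- The projection of the product algebra to the block of the weight vector `s`. -/
def evalBlock (J J' : ℕ) (s : Fin (J + 1)) :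
    (Fin (J + 1) → Matrix (Fin (J' + 1)) (Fin (J' + 1)) ℝ) →ₐ[ℝ]
      Matrix (Fin (J' + 1)) (Fin (J' + 1)) ℝ :=
  Pi.evalAlgHom ℝ _ s

theorem map_evalBlock_fexp_sigmaFamily (J J' : ℕ) (c : ℝ) (s : Fin (J + 1)) :
    PowerSeries.map (RingHomClass.toRingHom (evalBlock J J' s))
      (fexp (sigmaFamily J J' c)) = fexp ((c * (wt J s : ℤ)) • sigma (repJp J')) := by
  rw [map_fexp]
  congr 1
  ext n : 1
  simp [sigmaFamily, evalBlock]

theorem fexp_sigmaFamily_mul (J J' : ℕ) (c : ℝ) :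
    fexp (sigmaFamily J J' (-c)) * fexp (sigmaFamily J J' c) = 1 := by
  ext n s : 2
  have h : PowerSeries.map (RingHomClass.toRingHom (evalBlock J J' s))
      (fexp (sigmaFamily J J' (-c)) * fexp (sigmaFamily J J' c)) = 1 := by
    rw [map_mul, map_evalBlock_fexp_sigmaFamily, map_evalBlock_fexp_sigmaFamily,
      fexp_smul_sigma_mul, neg_mul, neg_add_cancel, fexp_zero_smul_sigma]
  have h' := congrArg (PowerSeries.coeff n) h
  rw [PowerSeries.coeff_map] at h'
  refine Eq.trans h' ?_
  rw [PowerSeries.coeff_one, PowerSeries.coeff_one]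
  split_ifs <;> rfl

theorem twist_eq_map_blockDiag (J J' : ℕ) :
    twist J J' = PowerSeries.map (blockDiag J J' : _ →+* TensorEnd J J')
      (fexp (sigmaFamily J J' (-(1 / 2)))) := by
  rw [map_fexp, twist]
  congr 1
  ext n ⟨t, t'⟩ ⟨s, s'⟩
  rw [PowerSeries.coeff_smul, J0TensorSigma, PowerSeries.coeff_mk, PowerSeries.coeff_map,
    sigmaFamily, PowerSeries.coeff_mk, RingHom.coe_coe, blockDiag_apply, Matrix.smul_apply,
    Matrix.kronecker, Matrix.kroneckerMap_apply, repJ0, Matrix.diagonal_apply]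
  split_ifs <;> simp [mul_assoc]

theorem twistInv_eq_map_blockDiag (J J' : ℕ) :
    twistInv J J' = PowerSeries.map (blockDiag J J' : _ →+* TensorEnd J J')
      (fexp (sigmaFamily J J' (1 / 2))) := by
  have h : twist J J' * PowerSeries.map (blockDiag J J' : _ →+* TensorEnd J J')
      (fexp (sigmaFamily J J' (1 / 2))) = 1 := by
    rw [twist_eq_map_blockDiag, ← map_mul, fexp_sigmaFamily_mul, map_one]
  exact left_inv_eq_right_inv (twistInv_mul_twist J J') h

/-- The matrix element `⟨j t| e^{cσ} |j s⟩` in the spin `J/2` representation. -/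
def expSigmaEntry (J : ℕ) (c : ℝ) (t s : Fin (J + 1)) : PowerSeries ℝ :=
  PowerSeries.mk fun n => negBinom c n * (((2 : ℝ) • repJp J) ^ n) t s

/-- The twist is diagonal in its first factor, on which `J₀` is a number:
`F⁻¹ |j m⟩ ⊗ v = |j m⟩ ⊗ e^{mσ} v`. -/
theorem twistInvEntry_eq (J J' : ℕ) (t : Fin (J + 1)) (t' : Fin (J' + 1))
    (s : Fin (J + 1)) (s' : Fin (J' + 1)) :
    twistInvEntry J J' t t' s s' =
      if t = s then expSigmaEntry J' ((wt J s : ℤ) / 2) t' s' else 0 := by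
  ext n
  have h := congrArg (PowerSeries.coeff n) (map_evalBlock_fexp_sigmaFamily J J' (1 / 2) t)
  rw [PowerSeries.coeff_map, coeff_fexp_smul_sigma] at h
  rw [twistInvEntry, PowerSeries.coeff_mk, twistInv_eq_map_blockDiag, PowerSeries.coeff_map,
    RingHom.coe_coe, blockDiag_apply]
  split_ifs with hts
  · subst hts
    have h' := congrFun (congrFun h t') s'
    simp only [RingHom.coe_coe, evalBlock, Pi.evalAlgHom_apply] at h'
    rw [h', expSigmaEntry, PowerSeries.coeff_mk, Matrix.smul_apply, smul_eq_mul]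
    congr 2
    ring
  · simp

end Twist

/-! ### Moving `e^{cσ}` across a multiplet -/

section Multiplet

theorem repJp_pow_apply_eq_zero {J : ℕ} {n : ℕ} {t s : Fin (J + 1)}
    (h : wt J t ≠ wt J s + 2 * n) : (((2 : ℝ) • repJp J) ^ n) t s = 0 := by
  induction n generalizing t with
  | zero =>
    rw [pow_zero, Matrix.one_apply_ne]
    rintro rfl
    simp at h
  | succ n ih =>
    rw [pow_succ', Matrix.mul_apply]
    refine Finset.sum_eq_zero fun r _ => ?_
    by_cases hr : wt J r = wt J s + 2 * n
    · have : wt J t ≠ wt J r + 2 := by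
        rw [hr]; push_cast at h; intro h'; apply h; rw [h']; ring
      simp [repJp, this]
    · rw [ih hr, mul_zero]

variable {A : Type*} [Ring A] [Algebra ℝ A]

/-- If `[y, ·]` acts on the family `x` by the matrix `N`, then
`yⁿ x_s = ∑ C(n, k) (x Nᵏ)_s yⁿ⁻ᵏ`. -/
theorem pow_mul_of_lie {ι : Type*} [Fintype ι] [DecidableEq ι] {y : A} {x : ι → A}
    {N : Matrix ι ι ℝ} (h : ∀ s, ⁅y, x s⁆ = ∑ t, N t s • x t) (n : ℕ) (s : ι) :
    y ^ n * x s = ∑ p ∈ Finset.HasAntidiagonal.antidiagonal n,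
      ((n.choose p.1 : ℕ) : ℝ) • ((∑ t, (N ^ p.1) t s • x t) * y ^ p.2) := by
  set L := LinearMap.mulLeft ℝ y
  set R := LinearMap.mulRight ℝ y
  have hLR : Commute L R := LinearMap.commute_mulLeft_right y y
  have hD : ∀ k s, ((L - R) ^ k) (x s) = ∑ t, (N ^ k) t s • x t := by
    intro k
    induction k with
    | zero => intro s; simp [Matrix.one_apply]
    | succ k ih =>
      intro s
      have h1 : (L - R) (x s) = ∑ t, N t s • x t := by
        rw [← h, Ring.lie_def]; rfl
      rw [pow_succ, Module.End.mul_apply, h1, map_sum]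
      simp only [map_smul, ih, pow_succ, Matrix.mul_apply, Finset.smul_sum, Finset.sum_smul]
      rw [Finset.sum_comm]
      refine Finset.sum_congr rfl fun _ _ => Finset.sum_congr rfl fun _ _ => ?_
      rw [smul_smul, mul_comm]
  -- `L = (L - R) + R` with commuting summands, and `L - R = [y, ·]`
  have hadd := ((hLR.sub_left (Commute.refl R)).add_pow' n)
  rw [sub_add_cancel] at hadd
  have h2 := congrArg (fun f : A →ₗ[ℝ] A => f (x s)) hadd
  have h3 : (L ^ n) (x s) = y ^ n * x s := by
    simp only [L, LinearMap.pow_mulLeft, LinearMap.mulLeft_apply]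
  simp only [h3, LinearMap.sum_apply] at h2
  rw [h2]
  refine Finset.sum_congr rfl fun p _ => ?_
  rw [((hLR.sub_left (Commute.refl R)).pow_pow _ _).eq, LinearMap.smul_apply,
    Module.End.mul_apply, hD, ← Nat.cast_smul_eq_nsmul ℝ]
  simp only [R, LinearMap.pow_mulRight, LinearMap.mulRight_apply]

/-- The relation `F⁻¹` encodes: moving `e^{cσ}` from the left of a spin `J/2` multiplet to its
right transforms the multiplet by the matrix of `e^{cσ}` and shifts the exponents by the change
of weight. -/
theorem expSigma_mul_const {a : A} {J : ℕ} {x : Fin (J + 1) → A}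
    (h : ∀ s, ⁅bosonJp a, x s⁆ = ∑ t, repJp J t s • x t) (c : ℝ) (s : Fin (J + 1)) :
    expSigma a c * const (x s) = ∑ t, PowerSeries.map (algebraMap ℝ A) (expSigmaEntry J c t s) *
      (const (x t) * expSigma a (c + ((wt J t : ℤ) - (wt J s : ℤ)) / 2)) := by
  have h' : ∀ s, ⁅-a ^ 2, x s⁆ = ∑ t, ((2 : ℝ) • repJp J) t s • x t := by
    intro s
    have : -a ^ 2 = (2 : ℝ) • bosonJp a := by rw [bosonJp, smul_smul]; norm_num
    rw [this, Ring.lie_def, smul_mul_assoc, mul_smul_comm, ← smul_sub, ← Ring.lie_def, h,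
      Finset.smul_sum]
    simp [mul_smul]
  ext n
  rw [const, PowerSeries.coeff_mul_C, coeff_expSigma, smul_mul_assoc, pow_mul_of_lie h', map_sum]
  simp only [PowerSeries.coeff_mul, Finset.smul_sum, Finset.sum_mul]
  rw [Finset.sum_comm]
  refine Finset.sum_congr rfl fun t _ => Finset.sum_congr rfl fun p hp => ?_
  rw [const, ← PowerSeries.coeff_mul, PowerSeries.coeff_C_mul, coeff_expSigma,
    PowerSeries.coeff_map, expSigmaEntry, PowerSeries.coeff_mk, ← Algebra.smul_def]
  -- only the power of `J₊` that carries `s` to `t` has a nonzero matrix element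
  by_cases hw : wt J t = wt J s + 2 * p.1
  · have hc : c + ((wt J t : ℤ) - (wt J s : ℤ)) / 2 = c + p.1 := by
      rw [hw]; push_cast; ring
    obtain ⟨k, m⟩ := p
    obtain rfl := Finset.HasAntidiagonal.mem_antidiagonal.mp hp
    have hb := negBinom_mul_negBinom c k m
    rw [hc]
    simp only [smul_mul_assoc, mul_smul_comm, smul_smul]
    congr 1
    linear_combination (-(((2 : ℝ) • repJp J) ^ k) t s) * hb
  · rw [repJp_pow_apply_eq_zero hw]
    simp

end Multiplet

/-! ### Weyl-ordered monomials -/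

section Weyl

variable {A : Type*} [Ring A] [Algebra ℝ A]

/-- The Weyl-ordered (symmetrized) monomial of degree `p` in `a` and `q` in `ā`. -/
def weyl (a abar : A) : ℕ → ℕ → A
  | 0, q => abar ^ q
  | p + 1, q => a * weyl a abar p q + ((q : ℝ) / 2) • weyl a abar p (q - 1)

theorem weyl_zero_left (a abar : A) (q : ℕ) : weyl a abar 0 q = abar ^ q := by rw [weyl]

theorem weyl_succ (a abar : A) (p q : ℕ) : weyl a abar (p + 1) q =
    a * weyl a abar p q + ((q : ℝ) / 2) • weyl a abar p (q - 1) := by rw [weyl]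

theorem weyl_zero_right (a abar : A) (p : ℕ) : weyl a abar p 0 = a ^ p := by
  induction p with
  | zero => simp [weyl_zero_left]
  | succ p ih => simp [weyl_succ, ih, pow_succ']

theorem weyl_pred (a abar : A) (p q : ℕ) : (p : ℝ) • weyl a abar p q =
    (p : ℝ) • (a * weyl a abar (p - 1) q + ((q : ℝ) / 2) • weyl a abar (p - 1) (q - 1)) := by
  rcases p with _ | p
  · simp
  · rw [weyl_succ, Nat.add_sub_cancel]

variable {a abar : A}

theorem lie_abar_weyl (hcomm : abar * a - a * abar = 1) (p q : ℕ) :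
    ⁅abar, weyl a abar p q⁆ = (p : ℝ) • weyl a abar (p - 1) q := by
  have h : abar * a = a * abar + 1 := by rw [← hcomm]; abel
  induction p generalizing q with
  | zero => simp [weyl_zero_left, Ring.lie_def, ← pow_succ, ← pow_succ']
  | succ p ih =>
    have e : ⁅abar, weyl a abar (p + 1) q⁆ = weyl a abar p q + a * ⁅abar, weyl a abar p q⁆
        + ((q : ℝ) / 2) • ⁅abar, weyl a abar p (q - 1)⁆ := by
      simp only [weyl_succ, Ring.lie_def, mul_add, add_mul, mul_sub, ← mul_assoc, h,
        mul_smul_comm, smul_mul_assoc, smul_sub, one_mul]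
      abel
    rw [e, ih, ih, mul_smul_comm, smul_comm, add_assoc, ← smul_add, ← weyl_pred]
    push_cast
    module

theorem abar_mul_weyl (hcomm : abar * a - a * abar = 1) (p q : ℕ) :
    abar * weyl a abar p q = weyl a abar p (q + 1) + ((p : ℝ) / 2) • weyl a abar (p - 1) q := by
  have h : abar * a = a * abar + 1 := by rw [← hcomm]; abel
  induction p generalizing q with
  | zero => simp [weyl_zero_left, pow_succ']
  | succ p ih =>
    have e : (q : ℝ) • weyl a abar p (q - 1 + 1) = (q : ℝ) • weyl a abar p q := by
      rcases q with _ | q <;> simp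
    have e' := weyl_pred a abar p q
    rw [weyl_succ, mul_add, ← mul_assoc, h, add_mul, mul_assoc, ih, mul_smul_comm, ih, one_mul,
      weyl_succ, Nat.add_sub_cancel, Nat.add_sub_cancel, mul_add, mul_smul_comm]
    push_cast
    linear_combination (norm := module) (1 / 2 : ℝ) • e - (1 / 2 : ℝ) • e'

theorem lie_bosonJm_weyl (hcomm : abar * a - a * abar = 1) (p q : ℕ) :
    ⁅bosonJm abar, weyl a abar p q⁆ = (p : ℝ) • weyl a abar (p - 1) (q + 1) := by
  have h1 := lie_abar_weyl hcomm p q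
  have h2 := lie_abar_weyl hcomm (p - 1) q
  have h3 := abar_mul_weyl hcomm (p - 1) q
  rw [Ring.lie_def] at h2
  have e : ⁅bosonJm abar, weyl a abar p q⁆ = (1 / 2 : ℝ) •
      (abar * ⁅abar, weyl a abar p q⁆ + ⁅abar, weyl a abar p q⁆ * abar) := by
    rw [bosonJm, Ring.lie_def, smul_mul_assoc, mul_smul_comm, ← smul_sub, Ring.lie_def]
    congr 1
    noncomm_ring
  rw [e, h1, mul_smul_comm, smul_mul_assoc, ← sub_sub_cancel (abar * weyl a abar (p - 1) q)
    (weyl a abar (p - 1) q * abar), h2, h3]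
  module

end Weyl

/-! ### The Moyal product of Weyl-ordered monomials -/

section Moyal

theorem invFact_of_neg {x : ℤ} (h : x < 0) : invFact x = 0 := if_pos h

theorem invFact_natCast (n : ℕ) : invFact n = (n.factorial : ℝ)⁻¹ := by
  simp [invFact]

@[simp] theorem invFact_zero : invFact 0 = 1 := by simpa using invFact_natCast 0

/-- With `1 / x! = 0` for `x < 0` this holds without restriction on `x`. -/
theorem mul_invFact (x : ℤ) : (x : ℝ) * invFact x = invFact (x - 1) := by
  rcases lt_trichotomy x 0 with h | rfl | h
  · rw [invFact_of_neg h, invFact_of_neg (by omega), mul_zero]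
  · rw [invFact_of_neg (by omega : (0 : ℤ) - 1 < 0)]; simp
  · obtain ⟨n, rfl⟩ : ∃ n : ℕ, x = (n + 1 : ℕ) := ⟨x.toNat - 1, by omega⟩
    rw [show ((n + 1 : ℕ) : ℤ) - 1 = n by push_cast; ring, invFact_natCast, invFact_natCast,
      Nat.factorial_succ]
    have h : (n.factorial : ℝ) ≠ 0 := by positivity
    push_cast
    field_simp

/-- The coefficient, in the Moyal product of the divided powers `a^p ā^q / (p! q!)` and
`a^p' ā^q' / (p'! q'!)`, of the term that contracts `ā` of the first factor with `a` of the second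
one `k` times, and `a` of the first factor with `ā` of the second one `l` times. -/
def moyalCoeff (p q p' q' : ℤ) (k l : ℕ) : ℝ :=
  (1 / 2) ^ (k + l) * (-1) ^ l * invFact k * invFact l * invFact (q - k) * invFact (p - l)
    * invFact (p' - k) * invFact (q' - l)

variable {A : Type*} [Ring A] [Algebra ℝ A]

/-- Weyl-ordered monomials with exponents in `ℤ`; the value is meaningful only for
nonnegative exponents. -/
def weylZ (a abar : A) (P Q : ℤ) : A := weyl a abar P.toNat Q.toNat

/-- The Moyal product of two divided powers. -/
def moyalSum (a abar : A) (p q : ℤ) (p' q' : ℕ) : A :=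
  ∑ k ∈ Finset.range (p' + 1), ∑ l ∈ Finset.range (q' + 1),
    moyalCoeff p q p' q' k l • weylZ a abar (p + p' - k - l) (q + q' - k - l)

theorem moyalCoeff_eq_zero {p q p' q' : ℤ} {k l : ℕ}
    (h : q < k ∨ p < l ∨ p' < k ∨ q' < l) : moyalCoeff p q p' q' k l = 0 := by
  rw [moyalCoeff]
  rcases h with h | h | h | h <;>
    rw [invFact_of_neg (sub_neg.mpr h)] <;> simp

theorem le_of_moyalCoeff_ne_zero {p q p' q' : ℤ} {k l : ℕ} (h : moyalCoeff p q p' q' k l ≠ 0) :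
    (k : ℤ) ≤ q ∧ (l : ℤ) ≤ p ∧ (k : ℤ) ≤ p' ∧ (l : ℤ) ≤ q' := by
  refine ⟨?_, ?_, ?_, ?_⟩ <;> by_contra h' <;> exact h (moyalCoeff_eq_zero (by omega))

theorem a_mul_weylZ (a abar : A) {P Q : ℤ} (hP : 0 ≤ P) (hQ : 0 ≤ Q) :
    a * weylZ a abar P Q = weylZ a abar (P + 1) Q - ((Q : ℝ) / 2) • weylZ a abar P (Q - 1) := by
  lift P to ℕ using hP
  lift Q to ℕ using hQ
  have h1 : ((P : ℤ) + 1).toNat = P + 1 := by omega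
  have h2 : ((Q : ℤ) - 1).toNat = Q - 1 := by omega
  simp only [weylZ, h1, h2, Int.toNat_natCast, weyl_succ, Int.cast_natCast]
  abel

theorem abar_mul_weylZ {a abar : A} (hcomm : abar * a - a * abar = 1) {P Q : ℤ} (hP : 0 ≤ P)
    (hQ : 0 ≤ Q) : abar * weylZ a abar P Q =
      weylZ a abar P (Q + 1) + ((P : ℝ) / 2) • weylZ a abar (P - 1) Q := by
  lift P to ℕ using hP
  lift Q to ℕ using hQ
  have h1 : ((Q : ℤ) + 1).toNat = Q + 1 := by omega
  have h2 : ((P : ℤ) - 1).toNat = P - 1 := by omega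
  simp only [weylZ, h1, h2, Int.toNat_natCast, Int.cast_natCast]
  exact abar_mul_weyl hcomm P Q

/-- The recursion in the degree in `a` of the first factor. -/
theorem moyalSum_succ_left (a abar : A) (p q : ℤ) (p' q' : ℕ) :
    ((p : ℝ) + 1) • moyalSum a abar (p + 1) q p' q' =
      a * moyalSum a abar p q p' q' + (1 / 2 : ℝ) • moyalSum a abar p (q - 1) p' q' := by
  simp only [moyalSum, Finset.smul_sum, Finset.mul_sum, ← Finset.sum_add_distrib]
  refine Finset.sum_congr rfl fun k _ => ?_
  -- the contribution of `l` contractions of `a` on the left matches those of `l` and `l - 1` on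
  -- the right
  set B : ℕ → A := fun l => weylZ a abar (p + 1 + p' - k - l) (q + q' - k - l) with hB
  have hB' : ∀ l : ℕ, weylZ a abar (p + p' - k - l) (q + q' - k - l - 1) = B (l + 1) := by
    intro l
    simp only [hB]
    congr 1 <;> push_cast <;> ring
  have h1 : ∀ l : ℕ, a * (moyalCoeff p q p' q' k l • weylZ a abar (p + p' - k - l)
      (q + q' - k - l)) + (1 / 2 : ℝ) • (moyalCoeff p (q - 1) p' q' k l •
        weylZ a abar (p + p' - k - l) (q - 1 + q' - k - l)) =
      moyalCoeff p q p' q' k l • B l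
        - ((1 / 2 : ℝ) * (q' - l) * moyalCoeff p q p' q' k l) • B (l + 1) := by
    intro l
    have hq : moyalCoeff p (q - 1) p' q' k l = ((q : ℝ) - k) * moyalCoeff p q p' q' k l := by
      have h := mul_invFact (q - k)
      rw [show q - (k : ℤ) - 1 = q - 1 - k by ring] at h
      rw [moyalCoeff, moyalCoeff, ← h]
      push_cast
      ring
    rw [hq, show q - 1 + (q' : ℤ) - k - l = q + q' - k - l - 1 by ring, hB']
    by_cases h0 : moyalCoeff p q p' q' k l = 0
    · simp [h0]
    · have := le_of_moyalCoeff_ne_zero h0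
      rw [mul_smul_comm, a_mul_weylZ a abar (by omega) (by omega), hB',
        show p + (p' : ℤ) - k - l + 1 = p + 1 + p' - k - l by ring]
      push_cast
      module
  rw [Finset.sum_congr rfl fun l _ => h1 l, Finset.sum_sub_distrib, eq_sub_iff_add_eq]
  have h2 : ∀ l : ℕ, ((p : ℝ) + 1) • (moyalCoeff (p + 1) q p' q' k l •
      weylZ a abar (p + 1 + p' - k - l) (q + q' - k - l)) = moyalCoeff p q p' q' k l • B l
        + ((l : ℝ) * moyalCoeff (p + 1) q p' q' k l) • B l := by
    intro l
    have hp : moyalCoeff p q p' q' k l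
        = ((p : ℝ) + 1 - l) * moyalCoeff (p + 1) q p' q' k l := by
      have h := mul_invFact (p + 1 - l)
      rw [show p + 1 - (l : ℤ) - 1 = p - l by ring] at h
      rw [moyalCoeff, moyalCoeff, ← h]
      push_cast
      ring
    rw [hp, smul_smul, ← add_smul]
    congr 1
    ring
  rw [Finset.sum_congr rfl fun l _ => h2 l, Finset.sum_add_distrib, add_assoc, add_eq_left,
    Finset.sum_range_succ', Finset.sum_range_succ _ q']
  simp only [Nat.cast_zero, zero_mul, zero_smul, add_zero, sub_self, mul_zero]
  rw [← Finset.sum_add_distrib]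
  refine Finset.sum_eq_zero fun l _ => ?_
  rw [← add_smul]
  convert zero_smul ℝ (B (l + 1))
  have h3 := mul_invFact ((l + 1 : ℕ) : ℤ)
  have h4 := mul_invFact ((q' : ℤ) - l)
  rw [show ((l + 1 : ℕ) : ℤ) - 1 = l by push_cast; ring] at h3
  rw [show (q' : ℤ) - l - 1 = q' - (l + 1 : ℕ) by push_cast; ring] at h4
  rw [moyalCoeff, moyalCoeff, ← h3, ← h4, show p + 1 - ((l + 1 : ℕ) : ℤ) = p - l by push_cast; ring]
  push_cast
  ring

theorem moyalSum_zero (a abar : A) (q : ℤ) (p' q' : ℕ) :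
    moyalSum a abar 0 q p' q' = ∑ k ∈ Finset.range (p' + 1),
      moyalCoeff 0 q p' q' k 0 • weylZ a abar (p' - k) (q + q' - k) := by
  refine Finset.sum_congr rfl fun k _ => ?_
  rw [Finset.sum_eq_single 0]
  · simp
  · intro l _ hl
    rw [moyalCoeff_eq_zero (Or.inr (Or.inl (by omega))), zero_smul]
  · simp

/-- The recursion in the degree in `ā` of the first factor, when that factor is a power of `ā`. -/
theorem moyalSum_zero_succ {a abar : A} (hcomm : abar * a - a * abar = 1) (q : ℤ) (p' q' : ℕ) :
    ((q : ℝ) + 1) • moyalSum a abar 0 (q + 1) p' q' = abar * moyalSum a abar 0 q p' q' := by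
  simp only [moyalSum_zero, Finset.smul_sum, Finset.mul_sum]
  -- the contribution of `k` contractions of `ā` on the left matches those of `k` and `k - 1` on
  -- the right
  set B : ℕ → A := fun k => weylZ a abar (p' - k) (q + 1 + q' - k) with hB
  have h1 : ∀ k : ℕ, abar * (moyalCoeff 0 q p' q' k 0 • weylZ a abar (p' - k) (q + q' - k)) =
      moyalCoeff 0 q p' q' k 0 • B k
        + ((1 / 2 : ℝ) * (p' - k) * moyalCoeff 0 q p' q' k 0) • B (k + 1) := by
    intro k
    by_cases h0 : moyalCoeff 0 q p' q' k 0 = 0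
    · simp [h0]
    · have := le_of_moyalCoeff_ne_zero h0
      rw [mul_smul_comm, abar_mul_weylZ hcomm (by omega) (by omega),
        show q + (q' : ℤ) - k + 1 = q + 1 + q' - k by ring,
        show (p' : ℤ) - k - 1 = p' - (k + 1 : ℕ) by push_cast; ring,
        show q + (q' : ℤ) - k = q + 1 + q' - (k + 1 : ℕ) by push_cast; ring]
      simp only [hB]
      push_cast
      module
  have h2 : ∀ k : ℕ, ((q : ℝ) + 1) • (moyalCoeff 0 (q + 1) p' q' k 0 •
      weylZ a abar (p' - k) (q + 1 + q' - k)) = moyalCoeff 0 q p' q' k 0 • B k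
        + ((k : ℝ) * moyalCoeff 0 (q + 1) p' q' k 0) • B k := by
    intro k
    have hq : moyalCoeff 0 q p' q' k 0
        = ((q : ℝ) + 1 - k) * moyalCoeff 0 (q + 1) p' q' k 0 := by
      have h := mul_invFact (q + 1 - k)
      rw [show q + 1 - (k : ℤ) - 1 = q - k by ring] at h
      rw [moyalCoeff, moyalCoeff, ← h]
      push_cast
      ring
    rw [hq, smul_smul, ← add_smul]
    congr 1
    ring
  rw [Finset.sum_congr rfl fun k _ => h1 k, Finset.sum_congr rfl fun k _ => h2 k,
    Finset.sum_add_distrib, Finset.sum_add_distrib]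
  congr 1
  rw [Finset.sum_range_succ', Finset.sum_range_succ _ p']
  simp only [Nat.cast_zero, zero_mul, zero_smul, add_zero, sub_self, mul_zero]
  refine Finset.sum_congr rfl fun k _ => ?_
  congr 1
  have h3 := mul_invFact ((k + 1 : ℕ) : ℤ)
  have h4 := mul_invFact ((p' : ℤ) - k)
  rw [show ((k + 1 : ℕ) : ℤ) - 1 = k by push_cast; ring] at h3
  rw [show (p' : ℤ) - k - 1 = p' - (k + 1 : ℕ) by push_cast; ring] at h4
  rw [moyalCoeff, moyalCoeff, ← h3, ← h4,
    show q + 1 - ((k + 1 : ℕ) : ℤ) = q - k by push_cast; ring]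
  push_cast
  ring

/-- The product of Weyl-ordered monomials is the Moyal product of their symbols. -/
theorem weyl_mul_weyl {a abar : A} (hcomm : abar * a - a * abar = 1) (p q p' q' : ℕ) :
    weyl a abar p q * weyl a abar p' q' =
      ((p.factorial : ℝ) * q.factorial * p'.factorial * q'.factorial) •
        moyalSum a abar p q p' q' := by
  have hfac : ∀ n : ℕ, (n.factorial : ℝ) ≠ 0 := fun n => by positivity
  induction p generalizing q with
  | zero =>
    induction q with
    | zero =>
      rw [weyl_zero_left, pow_zero, one_mul, Nat.cast_zero, moyalSum_zero, Finset.sum_eq_single 0]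
      · simp only [moyalCoeff, weylZ, smul_smul, Nat.cast_zero, sub_zero, zero_add,
          Int.toNat_natCast, invFact_natCast, invFact_zero, Nat.factorial_zero]
        rw [← one_smul ℝ (weyl a abar p' q'), smul_smul]
        congr 1
        have h1 := hfac p'
        have h2 := hfac q'
        push_cast
        field_simp
      · intro k _ hk
        rw [moyalCoeff_eq_zero (Or.inl (by omega)), zero_smul]
      · simp
    | succ q ih =>
      rw [weyl_zero_left] at ih ⊢
      have h := moyalSum_zero_succ hcomm q p' q'
      rw [pow_succ', mul_assoc, ih, mul_smul_comm, Nat.cast_zero, ← h, smul_smul,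
        Nat.factorial_succ]
      push_cast
      congr 1
      ring
  | succ p ih =>
    have h := moyalSum_succ_left a abar p q p' q'
    rw [weyl_succ, add_mul, mul_assoc, ih, smul_mul_assoc, ih, mul_smul_comm,
      eq_sub_of_add_eq h.symm, Nat.factorial_succ]
    rcases q with _ | q
    · have h0 : moyalSum a abar p (-1) p' q' = 0 :=
        Finset.sum_eq_zero fun k _ => Finset.sum_eq_zero fun l _ => by
          rw [moyalCoeff_eq_zero (Or.inl (by omega)), zero_smul]
      rw [Nat.cast_zero, zero_sub, h0]
      push_cast
      module
    · rw [show ((q + 1 : ℕ) : ℤ) - 1 = q by push_cast; ring, Nat.add_sub_cancel,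
        Nat.factorial_succ]
      push_cast
      module

end Moyal

/-! ### Racah's formula and the undeformed product law -/

section Racah

/-- The sum in Racah's formula for the Clebsch–Gordan coefficient, in terms of the exponents of
the two monomials and of the number `n` of contractions. -/
def racahSum (p q p' q' n : ℕ) : ℝ :=
  ∑ l ∈ Finset.range (n + 1), (-1 : ℝ) ^ l * invFact l * invFact ((n : ℤ) - l)
    * invFact ((q' : ℤ) - l) * invFact ((p : ℤ) - l) * invFact ((p' : ℤ) - n + l)
    * invFact ((q : ℤ) - n + l)

theorem fact_natCast (n : ℕ) : fact (n : ℤ) = n.factorial := by simp [fact]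

/-- The couplings are `j + j' - n`, where `n` is the number of contractions. -/
theorem sum_couplings {M : Type*} [AddCommMonoid M] (J J' : ℕ) (g : ℕ → M) :
    ∑ K ∈ couplings J J', g K = ∑ n ∈ Finset.range (min J J' + 1), g (J + J' - 2 * n) := by
  symm
  refine Finset.sum_nbij' (fun n => J + J' - 2 * n) (fun K => (J + J' - K) / 2) ?_ ?_ ?_ ?_ ?_
  · intro n hn
    rw [Finset.mem_range] at hn
    rw [couplings, Finset.mem_filter, Finset.mem_range, abs_le]
    refine ⟨by omega, ⟨by omega, by omega⟩, ?_⟩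
    rw [Nat.even_iff]
    omega
  · intro K hK
    rw [couplings, Finset.mem_filter, Finset.mem_range, abs_le, Nat.even_iff] at hK
    rw [Finset.mem_range]
    omega
  · intro n hn
    rw [Finset.mem_range] at hn
    omega
  · intro K hK
    rw [couplings, Finset.mem_filter, Finset.mem_range, abs_le, Nat.even_iff] at hK
    omega
  · intro n _
    rfl

theorem racahSum_eq_zero {p q p' q' n : ℕ} (h : p + p' < n ∨ q + q' < n) :
    racahSum p q p' q' n = 0 := by
  refine Finset.sum_eq_zero fun l _ => ?_
  by_cases h1 : p < l
  · rw [invFact_of_neg (by omega : (p : ℤ) - l < 0)]; simp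
  by_cases h2 : q' < l
  · rw [invFact_of_neg (by omega : (q' : ℤ) - l < 0)]; simp
  rcases h with h | h
  · rw [invFact_of_neg (by omega : (p' : ℤ) - n + l < 0)]; simp
  · rw [invFact_of_neg (by omega : (q : ℤ) - n + l < 0)]; simp

/-- The square roots in `⟨k|j|j'⟩` cancel those in the first factor of Racah's formula. -/
theorem triangleFactor_mul_clebschGordan {n p q p' q' K : ℕ} (hK : K + 2 * n = p + q + (p' + q'))
    (h : n ≤ p + q) (h' : n ≤ p' + q') (hP : n ≤ p + p') (hQ : n ≤ q + q') :
    triangleFactor K (p + q) (p' + q') *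
        clebschGordan (p' + q') ((p' : ℤ) - q') (p + q) ((p : ℤ) - q) K
          ((p' : ℤ) - q' + ((p : ℤ) - q)) =
      (1 / 2) ^ n * Real.sqrt ((p.factorial : ℝ) * q.factorial * (p'.factorial * q'.factorial) *
        ((p + p' - n).factorial * (q + q' - n).factorial)) * racahSum p q p' q' n := by
  have hM : |(p' : ℤ) - q' + ((p : ℤ) - q)| ≤ (K : ℤ) := abs_le.mpr ⟨by omega, by omega⟩
  rw [clebschGordan, if_pos (And.intro rfl hM), triangleFactor, nabla]
  have e1 : (((p' + q' : ℕ) : ℤ) + (p + q : ℕ) - K) / 2 = n := by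
    clear * - hK h h' hP hQ; omega
  have e2 : (((p' + q' : ℕ) : ℤ) - (p + q : ℕ) + K) / 2 = (p' + q' - n : ℕ) := by
    clear * - hK h h' hP hQ; omega
  have e3 : (-((p' + q' : ℕ) : ℤ) + (p + q : ℕ) + K) / 2 = (p + q - n : ℕ) := by
    clear * - hK h h' hP hQ; omega
  have e4 : (((p' + q' : ℕ) : ℤ) + (p + q : ℕ) + K) / 2 + 1
      = (p + q + (p' + q') - n + 1 : ℕ) := by
    clear * - hK h h' hP hQ; omega
  have e5 : (((p' + q' : ℕ) : ℤ) + ((p' : ℤ) - q')) / 2 = p' := by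
    clear * - hK h h' hP hQ; omega
  have e6 : (((p' + q' : ℕ) : ℤ) - ((p' : ℤ) - q')) / 2 = q' := by
    clear * - hK h h' hP hQ; omega
  have e7 : (((p + q : ℕ) : ℤ) + ((p : ℤ) - q)) / 2 = p := by
    clear * - hK h h' hP hQ; omega
  have e8 : (((p + q : ℕ) : ℤ) - ((p : ℤ) - q)) / 2 = q := by
    clear * - hK h h' hP hQ; omega
  have e9 : ((K : ℤ) + ((p' : ℤ) - q' + ((p : ℤ) - q))) / 2 = (p + p' - n : ℕ) := by
    clear * - hK h h' hP hQ; omega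
  have e10 : ((K : ℤ) - ((p' : ℤ) - q' + ((p : ℤ) - q))) / 2 = (q + q' - n : ℕ) := by
    clear * - hK h h' hP hQ; omega
  have e11 : ((K : ℤ) - (p + q : ℕ) + ((p' : ℤ) - q')) / 2 = (p' : ℤ) - n := by
    clear * - hK h h' hP hQ; omega
  have e12 : ((K : ℤ) - (p' + q' : ℕ) - ((p : ℤ) - q)) / 2 = (q : ℤ) - n := by
    clear * - hK h h' hP hQ; omega
  have e13 : (p' + q' + (p + q) - K) / 2 = n := by
    clear * - hK h h' hP hQ; omega
  have f1 : ((K : ℤ) + (p + q : ℕ) + (p' + q' : ℕ)) / 2 + 1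
      = (p + q + (p' + q') - n + 1 : ℕ) := by
    clear * - hK h h' hP hQ; omega
  have f2 : ((K : ℤ) + (p + q : ℕ) - (p' + q' : ℕ)) / 2 = (p + q - n : ℕ) := by
    clear * - hK h h' hP hQ; omega
  have f3 : ((K : ℤ) - (p + q : ℕ) + (p' + q' : ℕ)) / 2 = (p' + q' - n : ℕ) := by
    clear * - hK h h' hP hQ; omega
  have f4 : (-(K : ℤ) + (p + q : ℕ) + (p' + q' : ℕ)) / 2 = n := by
    clear * - hK h h' hP hQ; omega
  have f5 : ((K : ℤ) - (p + q : ℕ) - (p' + q' : ℕ)) / 2 = -(n : ℤ) := by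
    clear * - hK h h' hP hQ; omega
  rw [e1, e2, e3, e4, e5, e6, e7, e8, e9, e10, e11, e12, e13, f1, f2, f3, f4, f5]
  simp only [fact_natCast]
  have hK1 : (0 : ℝ) < (K : ℝ) + 1 := by positivity
  have hA : (0 : ℝ) < n.factorial := by positivity
  have hB : (0 : ℝ) < (p' + q' - n).factorial := by positivity
  have hC : (0 : ℝ) < (p + q - n).factorial := by positivity
  have hD : (0 : ℝ) < (p + q + (p' + q') - n + 1).factorial := by positivity
  set Af : ℝ := (n.factorial : ℝ)
  set Bf : ℝ := ((p' + q' - n).factorial : ℝ)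
  set Cf : ℝ := ((p + q - n).factorial : ℝ)
  set Df : ℝ := ((p + q + (p' + q') - n + 1).factorial : ℝ)
  have hs : Real.sqrt (Df / (Cf * Bf * Af)) * Real.sqrt (((K : ℝ) + 1) * Af * Bf * Cf / Df)
      = Real.sqrt ((K : ℝ) + 1) := by
    rw [← Real.sqrt_mul (by positivity)]
    congr 1
    field_simp
  have hz : (2 : ℝ) ^ (-(n : ℤ)) = (1 / 2) ^ n := by
    rw [zpow_neg, zpow_natCast, one_div, inv_pow]
  have hK2 : (Real.sqrt ((K : ℝ) + 1))⁻¹ * Real.sqrt ((K : ℝ) + 1) = 1 :=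
    inv_mul_cancel₀ (Real.sqrt_ne_zero'.mpr hK1)
  rw [hz, racahSum]
  generalize ∑ l ∈ Finset.range (n + 1), (-1 : ℝ) ^ l * invFact l * invFact ((n : ℤ) - l)
    * invFact ((q' : ℤ) - l) * invFact ((p : ℤ) - l) * invFact ((p' : ℤ) - n + l)
    * invFact ((q : ℤ) - n + l) = r
  have harg : (p'.factorial : ℝ) * q'.factorial * p.factorial * q.factorial
      * (p + p' - n).factorial * (q + q' - n).factorial
      = (p.factorial : ℝ) * q.factorial * (p'.factorial * q'.factorial) *
        ((p + p' - n).factorial * (q + q' - n).factorial) := by ring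
  rw [harg]
  generalize Real.sqrt ((p.factorial : ℝ) * q.factorial * (p'.factorial * q'.factorial) *
        ((p + p' - n).factorial * (q + q' - n).factorial)) = w
  calc _ = (1 / 2) ^ n * w * r * ((Real.sqrt ((K : ℝ) + 1))⁻¹ *
        (Real.sqrt (Df / (Cf * Bf * Af)) * Real.sqrt (((K : ℝ) + 1) * Af * Bf * Cf / Df))) := by
        ring
    _ = _ := by rw [hs, hK2, mul_one]

variable {A : Type*} [Ring A] [Algebra ℝ A]

/-- The Moyal product, sorted by the number `n = k + l` of contractions: the coefficient of each
term is `2⁻ⁿ` times the sum in Racah's formula. -/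
theorem moyalSum_eq_sum_racahSum (a abar : A) (p q p' q' : ℕ) :
    moyalSum a abar p q p' q' = ∑ n ∈ Finset.range (min (p + q) (p' + q') + 1),
      ((1 / 2) ^ n * racahSum p q p' q' n) •
        weylZ a abar ((p : ℤ) + p' - n) ((q : ℤ) + q' - n) := by
  have h1 : ∀ n : ℕ, ((1 / 2) ^ n * racahSum p q p' q' n) •
        weylZ a abar ((p : ℤ) + p' - n) ((q : ℤ) + q' - n) =
      ∑ x ∈ Finset.HasAntidiagonal.antidiagonal n, moyalCoeff p q p' q' x.2 x.1 •
        weylZ a abar ((p : ℤ) + p' - x.2 - x.1) ((q : ℤ) + q' - x.2 - x.1) := by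
    intro n
    rw [Finset.Nat.sum_antidiagonal_eq_sum_range_succ (f := fun l k => moyalCoeff p q p' q' k l •
        weylZ a abar ((p : ℤ) + p' - k - l) ((q : ℤ) + q' - k - l)), racahSum, Finset.mul_sum,
      Finset.sum_smul]
    refine Finset.sum_congr rfl fun l hl => ?_
    have hln : l ≤ n := by rw [Finset.mem_range] at hl; omega
    rw [moyalCoeff, Nat.sub_add_cancel hln, Nat.cast_sub hln,
      show (p : ℤ) + p' - ((n : ℤ) - l) - l = p + p' - n by ring,
      show (q : ℤ) + q' - ((n : ℤ) - l) - l = q + q' - n by ring,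
      show (q : ℤ) - ((n : ℤ) - l) = q - n + l by ring,
      show (p' : ℤ) - ((n : ℤ) - l) = p' - n + l by ring]
    congr 1
    ring
  rw [Finset.sum_congr rfl fun n _ => h1 n, Finset.sum_sigma', moyalSum, ← Finset.sum_product']
  symm
  refine Finset.sum_bij_ne_zero (fun x _ _ => (x.2.2, x.2.1)) ?_ ?_ ?_ ?_
  · rintro ⟨n, l, k⟩ _ h
    have := le_of_moyalCoeff_ne_zero (left_ne_zero_of_smul h)
    dsimp only at this ⊢
    rw [Finset.mem_product, Finset.mem_range, Finset.mem_range]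
    dsimp only
    omega
  · rintro ⟨n, l, k⟩ h _ ⟨n', l', k'⟩ h' _ e
    rw [Finset.mem_sigma, Finset.HasAntidiagonal.mem_antidiagonal] at h h'
    obtain ⟨rfl, rfl⟩ := Prod.mk.inj e
    obtain rfl : n = n' := h.2.symm.trans h'.2
    rfl
  · rintro ⟨k, l⟩ _ h
    have := le_of_moyalCoeff_ne_zero (left_ne_zero_of_smul h)
    dsimp only at this
    refine ⟨⟨l + k, l, k⟩, ?_, h, rfl⟩
    rw [Finset.mem_sigma, Finset.HasAntidiagonal.mem_antidiagonal, Finset.mem_range]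
    exact ⟨by dsimp only; omega, rfl⟩
  · intros
    rfl

/-- The product law of the undeformed symplecton, with leading constants `μ_{2j} / √(2j)!`. -/
theorem symplecton_mul {a abar : A} (hcomm : abar * a - a * abar = 1) {μ : ℕ → ℝ}
    (hμ : ∀ K, μ K ≠ 0) {C : ℕ → ℤ → A}
    (hC : ∀ p q : ℕ, C (p + q) ((p : ℤ) - q) =
      (μ (p + q) / Real.sqrt ((p.factorial : ℝ) * q.factorial)) • weyl a abar p q)
    (p q p' q' : ℕ) :
    C (p + q) ((p : ℤ) - q) * C (p' + q') ((p' : ℤ) - q') =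
      ∑ K ∈ couplings (p + q) (p' + q'),
        (μ (p + q) * μ (p' + q') / μ K * (triangleFactor K (p + q) (p' + q') *
          clebschGordan (p' + q') ((p' : ℤ) - q') (p + q) ((p : ℤ) - q) K
            ((p' : ℤ) - q' + ((p : ℤ) - q)))) • C K ((p' : ℤ) - q' + ((p : ℤ) - q)) := by
  rw [hC, hC, smul_mul_smul_comm, weyl_mul_weyl hcomm, smul_smul, moyalSum_eq_sum_racahSum,
    sum_couplings, Finset.smul_sum]
  refine Finset.sum_congr rfl fun n hn => ?_
  rw [Finset.mem_range] at hn
  have hK : p + q + (p' + q') - 2 * n + 2 * n = p + q + (p' + q') := by omega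
  set K := p + q + (p' + q') - 2 * n
  -- otherwise `|m + m'| > k`, and both sides vanish
  by_cases hPQ : n ≤ p + p' ∧ n ≤ q + q'
  · rw [triangleFactor_mul_clebschGordan hK (by omega) (by omega) hPQ.1 hPQ.2]
    have hM : (p' : ℤ) - q' + ((p : ℤ) - q) = ((p + p' - n : ℕ) : ℤ) - (q + q' - n : ℕ) := by
      omega
    have hP : ((p : ℤ) + p' - n).toNat = p + p' - n := by omega
    have hQ : ((q : ℤ) + q' - n).toNat = q + q' - n := by omega
    have hKeq : K = (p + p' - n) + (q + q' - n) := by omega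
    have hCK := hC (p + p' - n) (q + q' - n)
    rw [← hKeq] at hCK
    rw [hM, hCK, weylZ, hP, hQ, smul_smul, smul_smul]
    congr 1
    have hx : (0 : ℝ) < p.factorial * q.factorial := by positivity
    have hy : (0 : ℝ) < p'.factorial * q'.factorial := by positivity
    have hz : (0 : ℝ) < (p + p' - n).factorial * (q + q' - n).factorial := by positivity
    have hx' : (p.factorial : ℝ) * q.factorial * p'.factorial * q'.factorial =
      (p.factorial * q.factorial) * (p'.factorial * q'.factorial) := by ring
    rw [hx']
    set x : ℝ := p.factorial * q.factorial
    set y : ℝ := p'.factorial * q'.factorial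
    set z : ℝ := (p + p' - n).factorial * (q + q' - n).factorial
    clear_value x y z
    have h6 := Real.sqrt_ne_zero'.mpr hz
    have h7 := hμ K
    rw [Real.sqrt_mul (by positivity), Real.sqrt_mul (by positivity)]
    calc _ = μ (p + q) * μ (p' + q') * (1 / 2) ^ n * racahSum p q p' q' n
          * (x / Real.sqrt x) * (y / Real.sqrt y) := by ring
      _ = μ (p + q) * μ (p' + q') * (1 / 2) ^ n * racahSum p q p' q' n
          * Real.sqrt x * Real.sqrt y := by rw [Real.div_sqrt, Real.div_sqrt]
      _ = _ := by field_simp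
  · have h0 : clebschGordan (p' + q') ((p' : ℤ) - q') (p + q) ((p : ℤ) - q) K
        ((p' : ℤ) - q' + ((p : ℤ) - q)) = 0 := by
      rw [clebschGordan, if_neg]
      rintro ⟨-, h⟩
      rw [abs_le] at h
      omega
    rw [h0, racahSum_eq_zero (by omega)]
    simp

end Racah

/-! ### From the symplecton to the `h`-symplecton -/

section ConstantCoeff

variable {A : Type*} [Ring A]

theorem constantCoeff_const (x : A) : PowerSeries.constantCoeff (const x) = x := by
  simp [const]

theorem constantCoeff_lie (f g : PowerSeries A) :
    PowerSeries.constantCoeff ⁅f, g⁆ =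
      ⁅PowerSeries.constantCoeff f, PowerSeries.constantCoeff g⁆ := by
  simp only [Ring.lie_def, map_sub, map_mul]

theorem constantCoeff_hbar : PowerSeries.constantCoeff (hbar : PowerSeries A) = 0 := by
  simp [hbar]

end ConstantCoeff

section Symplecton

variable {A : Type*} [Ring A] [Algebra ℝ A] {a abar : A}

theorem constantCoeff_expSigma (a : A) (c : ℝ) :
    PowerSeries.constantCoeff (expSigma a c) = 1 := by
  rw [← PowerSeries.coeff_zero_eq_constantCoeff_apply, coeff_expSigma]
  simp

theorem constantCoeff_smul (r : ℝ) (f : PowerSeries A) :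
    PowerSeries.constantCoeff (r • f) = r • PowerSeries.constantCoeff f := by
  simp only [← PowerSeries.coeff_zero_eq_constantCoeff_apply, PowerSeries.coeff_smul]

theorem constantCoeff_adJ0 (t : PowerSeries A) : PowerSeries.constantCoeff (adJ0 a abar t) =
    ⁅bosonJ0 a abar, PowerSeries.constantCoeff t⁆ := by
  simp only [adJ0, map_mul, constantCoeff_lie, constantCoeff_const, constantCoeff_expSigma, mul_one]

theorem constantCoeff_adJp (t : PowerSeries A) : PowerSeries.constantCoeff (adJp a t) =
    ⁅bosonJp a, PowerSeries.constantCoeff t⁆ := by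
  simp only [adJp, map_mul, constantCoeff_lie, constantCoeff_const, constantCoeff_expSigma,
    mul_one, one_mul]

theorem constantCoeff_adJm (t : PowerSeries A) : PowerSeries.constantCoeff (adJm a abar t) =
    ⁅bosonJm abar, PowerSeries.constantCoeff t⁆ := by
  simp only [adJm, map_mul, map_add, map_sub, constantCoeff_smul, constantCoeff_lie,
    constantCoeff_const, constantCoeff_expSigma, constantCoeff_hbar, mul_one, zero_mul, smul_zero,
    add_zero, sub_zero]

theorem lowerCoeff_eq (p q : ℕ) :
    lowerCoeff (p + 1 + q) (((p + 1 : ℕ) : ℤ) - q) = Real.sqrt (((p : ℝ) + 1) * (q + 1)) := by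
  rw [lowerCoeff]
  congr 1
  push_cast
  ring

variable {ν : ℕ → ℝ} {P : ℕ → ℤ → PowerSeries A}

theorem IsHSymplecton.adJ0_eq (hP : IsHSymplecton a abar ν P) (p q : ℕ) :
    adJ0 a abar (P (p + q) ((p : ℤ) - q)) = ((p : ℝ) - q) • P (p + q) ((p : ℤ) - q) := by
  have h := hP.ad_J0 (p + q) ⟨q, by omega⟩
  have hw : wt (p + q) ⟨q, by omega⟩ = (p : ℤ) - q := by
    rw [wt]; push_cast; ring
  rw [hw] at h
  rw [h]
  push_cast
  rfl

theorem IsHSymplecton.adJm_eq (hP : IsHSymplecton a abar ν P) (p q : ℕ) :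
    adJm a abar (P (p + 1 + q) (((p + 1 : ℕ) : ℤ) - q)) =
      Real.sqrt (((p : ℝ) + 1) * (q + 1)) • P (p + (q + 1)) ((p : ℤ) - (q + 1 : ℕ)) := by
  have h := hP.ad_Jm (p + 1 + q) ⟨q, by omega⟩
  have hw : wt (p + 1 + q) ⟨q, by omega⟩ = ((p + 1 : ℕ) : ℤ) - q := by
    rw [wt]; push_cast; ring
  rw [hw, lowerCoeff_eq] at h
  rw [h, show p + 1 + q = p + (q + 1) by ring,
    show ((p + 1 : ℕ) : ℤ) - q - 2 = (p : ℤ) - (q + 1 : ℕ) by push_cast; ring]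

/-- At `h = 0` the `h`-symplecton consists of the Weyl-ordered monomials. -/
theorem IsHSymplecton.constantCoeff_eq (hcomm : abar * a - a * abar = 1)
    (hP : IsHSymplecton a abar ν P) (p q : ℕ) :
    PowerSeries.constantCoeff (P (p + q) ((p : ℤ) - q)) =
      (ν (p + q) * Real.sqrt (p + q).factorial / Real.sqrt ((p.factorial : ℝ) * q.factorial)) •
        weyl a abar p q := by
  induction q generalizing p with
  | zero =>
    have h := congrArg PowerSeries.constantCoeff (hP.top p)
    rw [constantCoeff_smul, map_mul, constantCoeff_const, constantCoeff_expSigma, mul_one] at h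
    have hp : Real.sqrt (p.factorial : ℝ) ≠ 0 := Real.sqrt_ne_zero'.mpr (by positivity)
    simp only [add_zero, Nat.cast_zero, sub_zero, Nat.factorial_zero, Nat.cast_one, mul_one]
    rw [h, weyl_zero_right, mul_div_assoc, div_self hp, mul_one]
  | succ q ih =>
    have h := congrArg PowerSeries.constantCoeff (hP.adJm_eq p q)
    have hs : Real.sqrt (((p : ℝ) + 1) * (q + 1)) ≠ 0 := Real.sqrt_ne_zero'.mpr (by positivity)
    rw [constantCoeff_adJm, ih, constantCoeff_smul, Ring.lie_def, mul_smul_comm, smul_mul_assoc,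
      ← smul_sub, ← Ring.lie_def, lie_bosonJm_weyl hcomm, Nat.add_sub_cancel,
      show p + 1 + q = p + (q + 1) by ring] at h
    rw [← inv_smul_eq_iff₀ hs] at h
    rw [← h, smul_smul, smul_smul]
    congr 1
    have e1 : (((p + 1).factorial : ℕ) : ℝ) * q.factorial =
        (p + 1) * (p.factorial * q.factorial) := by
      rw [Nat.factorial_succ]; push_cast; ring
    have e2 : ((p.factorial : ℕ) : ℝ) * (q + 1).factorial =
        (q + 1) * (p.factorial * q.factorial) := by
      rw [Nat.factorial_succ]; push_cast; ring
    have hx : (0 : ℝ) < p.factorial * q.factorial := by positivity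
    rw [e1, e2]
    generalize ((p.factorial : ℝ) * q.factorial) = x at hx ⊢
    rw [Real.sqrt_mul (by positivity), Real.sqrt_mul (by positivity),
      Real.sqrt_mul (by positivity)]
    have h1 : Real.sqrt x ≠ 0 := Real.sqrt_ne_zero'.mpr hx
    have h2 : Real.sqrt ((p : ℝ) + 1) ≠ 0 := Real.sqrt_ne_zero'.mpr (by positivity)
    have h3 : Real.sqrt ((q : ℝ) + 1) ≠ 0 := Real.sqrt_ne_zero'.mpr (by positivity)
    have h4 : Real.sqrt ((p : ℝ) + 1) ^ 2 = p + 1 := Real.sq_sqrt (by positivity)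
    field_simp
    rw [h4]
    push_cast
    ring

/-- The `h`-symplecton is the symplecton, multiplied by `e^{mσ}`. -/
theorem IsHSymplecton.eq_const_mul_expSigma (hcomm : abar * a - a * abar = 1)
    (hP : IsHSymplecton a abar ν P) (p q : ℕ) :
    P (p + q) ((p : ℤ) - q) = const (PowerSeries.constantCoeff (P (p + q) ((p : ℤ) - q))) *
      expSigma a (((p : ℝ) - q) / 2) := by
  induction q generalizing p with
  | zero =>
    have h := hP.top p
    have h' := congrArg PowerSeries.constantCoeff h
    rw [constantCoeff_smul, map_mul, constantCoeff_const, constantCoeff_expSigma, mul_one] at h'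
    simp only [add_zero, Nat.cast_zero, sub_zero]
    rw [h', h, const_smul, smul_mul_assoc]
  | succ q ih =>
    have h := hP.adJm_eq p q
    have hs : Real.sqrt (((p : ℝ) + 1) * (q + 1)) ≠ 0 := Real.sqrt_ne_zero'.mpr (by positivity)
    have h0 := congrArg PowerSeries.constantCoeff h
    rw [constantCoeff_adJm, constantCoeff_smul] at h0
    have hw := congrArg PowerSeries.constantCoeff (hP.adJ0_eq (p + 1) q)
    rw [constantCoeff_adJ0, constantCoeff_smul] at hw
    rw [ih, adJm_const_mul_expSigma hcomm (by rw [hw]; congr 1; ring), h0, const_smul,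
      smul_mul_assoc, show (((p + 1 : ℕ) : ℝ) - q) / 2 - 1 = ((p : ℝ) - (q + 1 : ℕ)) / 2 by
        push_cast; ring] at h
    exact (smul_right_injective (PowerSeries A) hs h).symm

theorem wt_eq_sub (J : ℕ) (s : Fin (J + 1)) : wt J s = ((J - s : ℕ) : ℤ) - (s : ℕ) := by
  rw [wt]; omega

theorem add_val_eq {J : ℕ} (s : Fin (J + 1)) : J - s + s = J := by omega

theorem IsHSymplecton.apply_wt (hcomm : abar * a - a * abar = 1)
    (hP : IsHSymplecton a abar ν P) (J : ℕ) (s : Fin (J + 1)) :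
    P J (wt J s) = const (PowerSeries.constantCoeff (P J (wt J s))) *
      expSigma a ((wt J s : ℤ) / 2) := by
  have h := hP.eq_const_mul_expSigma hcomm (J - s) s
  rw [add_val_eq, ← wt_eq_sub] at h
  rw [wt_eq_sub J s] at h ⊢
  push_cast at h ⊢
  exact h

theorem IsHSymplecton.apply_weight (hcomm : abar * a - a * abar = 1)
    (hP : IsHSymplecton a abar ν P) {K : ℕ} {M : ℤ} (hM : |M| ≤ K) (hK : Even (K + M)) :
    P K M = const (PowerSeries.constantCoeff (P K M)) * expSigma a ((M : ℝ) / 2) := by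
  rw [abs_le] at hM
  obtain ⟨r, hr⟩ := hK
  have hw : wt K ⟨(K - r).toNat, by omega⟩ = M := by
    simp only [wt]; omega
  have h := hP.apply_wt hcomm K ⟨(K - r).toNat, by omega⟩
  rwa [hw] at h

theorem IsHSymplecton.lie_bosonJp_constantCoeff (hP : IsHSymplecton a abar ν P) (J : ℕ)
    (s : Fin (J + 1)) : ⁅bosonJp a, PowerSeries.constantCoeff (P J (wt J s))⁆ =
      ∑ t, repJp J t s • PowerSeries.constantCoeff (P J (wt J t)) := by
  have h := congrArg PowerSeries.constantCoeff (hP.ad_Jp J s)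
  rw [constantCoeff_adJp, constantCoeff_smul] at h
  rw [h]
  obtain ⟨s, hs⟩ := s
  rcases s with _ | s
  · have h0 : raiseCoeff J (wt J ⟨0, hs⟩) = 0 := by simp [raiseCoeff, wt]
    rw [h0, zero_smul]
    refine (Finset.sum_eq_zero fun t _ => ?_).symm
    have : wt J t ≠ wt J ⟨0, hs⟩ + 2 := by simp only [wt]; omega
    rw [repJp, Matrix.of_apply, if_neg this, zero_smul]
  · have hw : wt J ⟨s, by omega⟩ = wt J ⟨s + 1, hs⟩ + 2 := by simp only [wt]; omega
    rw [Finset.sum_eq_single ⟨s, by omega⟩]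
    · simp only [repJp, Matrix.of_apply]
      rw [if_pos hw, hw]
    · intro t _ ht
      have : wt J t ≠ wt J ⟨s + 1, hs⟩ + 2 := by
        intro h'
        apply ht
        ext
        simp only [wt] at h' ⊢
        omega
      simp [repJp, this]
    · simp

/-- Power series with real coefficients are central in `A⟦h⟧`. -/
theorem map_algebraMap_mul_comm (f : PowerSeries ℝ) (g : PowerSeries A) :
    PowerSeries.map (algebraMap ℝ A) f * g = g * PowerSeries.map (algebraMap ℝ A) f := by
  ext n
  rw [PowerSeries.coeff_mul, PowerSeries.coeff_mul, ← Finset.Nat.sum_antidiagonal_swap]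
  refine Finset.sum_congr rfl fun p _ => ?_
  rw [PowerSeries.coeff_map, PowerSeries.coeff_map]
  exact Algebra.commutes _ _

/-- The product law for arbitrary nonzero leading constants. -/
theorem IsHSymplecton.mul (hcomm : abar * a - a * abar = 1) (hP : IsHSymplecton a abar ν P)
    (hν : ∀ n, ν n ≠ 0) (J J' : ℕ) (s : Fin (J + 1)) (s' : Fin (J' + 1)) :
    P J (wt J s) * P J' (wt J' s') =
      ∑ K ∈ couplings J J', ∑ t : Fin (J + 1), ∑ t' : Fin (J' + 1),
        (ν J * Real.sqrt J.factorial * (ν J' * Real.sqrt J'.factorial)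
            / (ν K * Real.sqrt K.factorial) * (triangleFactor K J J' *
            clebschGordan J' (wt J' t') J (wt J s) K (wt J' t' + wt J s))) •
          (PowerSeries.map (algebraMap ℝ A) (twistInvEntry J J' t t' s s') *
            P K (wt J' t' + wt J s)) := by
  set C : ℕ → ℤ → A := fun K M => PowerSeries.constantCoeff (P K M) with hC
  have hμ : ∀ n, ν n * Real.sqrt n.factorial ≠ 0 := fun n =>
    mul_ne_zero (hν n) (Real.sqrt_ne_zero'.mpr (by positivity))
  have hmul : ∀ t' : Fin (J' + 1), C J (wt J s) * C J' (wt J' t') =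
      ∑ K ∈ couplings J J', (ν J * Real.sqrt J.factorial * (ν J' * Real.sqrt J'.factorial)
            / (ν K * Real.sqrt K.factorial) * (triangleFactor K J J' *
            clebschGordan J' (wt J' t') J (wt J s) K (wt J' t' + wt J s))) •
          C K (wt J' t' + wt J s) := by
    intro t'
    have h := symplecton_mul hcomm hμ (C := C)
      (fun p q => hP.constantCoeff_eq hcomm p q) (J - s) s (J' - t') t'
    rwa [add_val_eq, add_val_eq, ← wt_eq_sub, ← wt_eq_sub] at h
  -- outside the weights of spin `K/2` the value of `P` is arbitrary, but the coefficient vanishes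
  have hterm : ∀ K ∈ couplings J J', ∀ t' : Fin (J' + 1),
      clebschGordan J' (wt J' t') J (wt J s) K (wt J' t' + wt J s) • P K (wt J' t' + wt J s) =
      clebschGordan J' (wt J' t') J (wt J s) K (wt J' t' + wt J s) •
        (const (C K (wt J' t' + wt J s)) *
          expSigma a (((wt J' t' + wt J s : ℤ) : ℝ) / 2)) := by
    intro K hK t'
    by_cases hM : |wt J' t' + wt J s| ≤ (K : ℤ)
    · rw [hC]
      dsimp only
      rw [← hP.apply_weight hcomm hM]
      rw [couplings, Finset.mem_filter, Nat.even_iff] at hK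
      rw [wt, wt, Int.even_iff]
      omega
    · rw [clebschGordan, if_neg (fun h => hM h.2), zero_smul, zero_smul]
  have hconst : ∀ f : Finset ℕ, ∀ g : ℕ → A, const (∑ K ∈ f, g K) = ∑ K ∈ f, const (g K) :=
    fun f g => map_sum PowerSeries.C g f
  rw [hP.apply_wt hcomm J s, hP.apply_wt hcomm J' s', mul_assoc, ← mul_assoc (expSigma a _),
    expSigma_mul_const (x := fun s' => C J' (wt J' s'))
      (fun s' => hP.lie_bosonJp_constantCoeff J' s'), Finset.sum_mul, Finset.mul_sum]
  -- the twist is diagonal in its first factor, so only `t = s` contributes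
  have hdiag : ∀ F : ℕ → Fin (J' + 1) → ℝ, ∀ Q : ℕ → Fin (J' + 1) → PowerSeries A,
      ∀ K, ∑ t : Fin (J + 1), ∑ t' : Fin (J' + 1), F K t' •
        (PowerSeries.map (algebraMap ℝ A) (twistInvEntry J J' t t' s s') * Q K t') =
      ∑ t' : Fin (J' + 1), F K t' • (PowerSeries.map (algebraMap ℝ A)
        (expSigmaEntry J' ((wt J s : ℤ) / 2) t' s') * Q K t') := by
    intro F Q K
    rw [Finset.sum_eq_single s]
    · simp only [twistInvEntry_eq, if_true]
    · intro t _ ht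
      simp only [twistInvEntry_eq, if_neg ht, map_zero, zero_mul, smul_zero,
        Finset.sum_const_zero]
    · simp
  rw [Finset.sum_congr rfl fun K _ => hdiag (fun K t' => ν J * Real.sqrt J.factorial *
    (ν J' * Real.sqrt J'.factorial) / (ν K * Real.sqrt K.factorial) * (triangleFactor K J J' *
      clebschGordan J' (wt J' t') J (wt J s) K (wt J' t' + wt J s)))
    (fun K t' => P K (wt J' t' + wt J s)) K, Finset.sum_comm]
  refine Finset.sum_congr rfl fun t' _ => ?_
  rw [mul_assoc, ← mul_assoc (const _), ← map_algebraMap_mul_comm, mul_assoc, mul_assoc,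
    expSigma_mul a (e := ((wt J' t' + wt J s : ℤ) : ℝ) / 2) (by push_cast; ring),
    ← mul_assoc (const _) (const _), ← const_mul, hmul, hconst, Finset.sum_mul, Finset.mul_sum]
  refine Finset.sum_congr rfl fun K hK => ?_
  have h := hterm K hK t'
  simp only [mul_smul, ← mul_smul_comm, h]
  simp only [const_smul, smul_mul_assoc, mul_smul_comm]

end Symplecton

end

end HSymplecton

open HSymplecton in
theorem theorem1 {A : Type*} [Ring A] [Algebra ℝ A] (a abar : A)
    (hcomm : abar * a - a * abar = 1) :
    (∀ P : ℕ → ℤ → PowerSeries A,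
      IsHSymplecton a abar (fun n => (Real.sqrt (n.factorial : ℝ))⁻¹) P →
      ∀ (J J' : ℕ) (s : Fin (J + 1)) (s' : Fin (J' + 1)),
        P J (wt J s) * P J' (wt J' s') =
          ∑ K ∈ couplings J J', ∑ t : Fin (J + 1), ∑ t' : Fin (J' + 1),
            (triangleFactor K J J' *
                clebschGordan J' (wt J' t') J (wt J s) K (wt J' t' + wt J s)) •
              (PowerSeries.map (algebraMap ℝ A) (twistInvEntry J J' t t' s s') *
                P K (wt J' t' + wt J s))) ∧
    (∀ P : ℕ → ℤ → PowerSeries A,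
      IsHSymplecton a abar (fun _ => 1) P →
      ∀ (J J' : ℕ) (s : Fin (J + 1)) (s' : Fin (J' + 1)),
        P J (wt J s) * P J' (wt J' s') =
          ∑ K ∈ couplings J J', ∑ t : Fin (J + 1), ∑ t' : Fin (J' + 1),
            (Real.sqrt ((J.factorial : ℝ) * J'.factorial / K.factorial) *
                triangleFactor K J J' *
                clebschGordan J' (wt J' t') J (wt J s) K (wt J' t' + wt J s)) •
              (PowerSeries.map (algebraMap ℝ A) (twistInvEntry J J' t t' s s') *
                P K (wt J' t' + wt J s))) := by
  refine ⟨fun P hP J J' s s' => ?_, fun P hP J J' s s' => ?_⟩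
  · have hfac : ∀ n : ℕ, Real.sqrt (n.factorial : ℝ) ≠ 0 := fun n =>
      Real.sqrt_ne_zero'.mpr (by positivity)
    rw [hP.mul hcomm fun n => inv_ne_zero (hfac n)]
    refine Finset.sum_congr rfl fun K _ => Finset.sum_congr rfl fun t _ =>
      Finset.sum_congr rfl fun t' _ => ?_
    rw [inv_mul_cancel₀ (hfac J), inv_mul_cancel₀ (hfac J'), inv_mul_cancel₀ (hfac K), one_mul,
      div_one, one_mul]
  · rw [hP.mul hcomm fun _ => one_ne_zero]
    refine Finset.sum_congr rfl fun K _ => Finset.sum_congr rfl fun t _ =>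
      Finset.sum_congr rfl fun t' _ => ?_
    rw [one_mul, one_mul, one_mul, ← Real.sqrt_mul (by positivity),
      ← Real.sqrt_div (by positivity), mul_assoc (Real.sqrt _)]
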